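/- **Setting.** Let $\mu\subseteq\lambda$ be partitions, $d=\ell(\lambda)$, and let $a\ge d$, $b\ge\lambda_1$, so that $\lambda$ and $\mu$ fit in an $a\times b$ box ($a$ rows, $b$ columns). For a cell $u=(i,j)$ let $c(u)=j-i$ and let $h(u)$ be its hook length in $\lambda$. Put $C=|\lambda/\mu|!\,/\prod_{u\in[\lambda]}h(u)$. The two formulas for the number $f^{\lambda/\mu}$ of standard Young tableaux of shape $\lambda/\mu$ are $$f^{\lambda/\mu}=C\sum_{T\in \mathrm{SSYT}(\mu,d)}\ \prod_{u\in[\mu]}\bigl(\lambda_{d+1-T(u)}-c(u)\bigr)\quad\text{(Okounkov–Olshanski)},\qquad f^{\lambda/\mu}=C\sum_{P\in\Delta^{\lambda\mu}_\lambda}\ \prod_{p\in\lozenge(P)}\operatorname{ht}(p)\quad\text{(Knutson–Tao)},$$ where $\mathrm{SSYT}(\mu,d)$ is the set of semistandard tableaux of shape $\mu$ with entries in $\{1,\dots,d\}$. The other objects are as follows; all regions lie in the triangular lattice of side length $1$ with horizontal edges. - $\mathcal{OOT}(\lambda/\mu)$ is the set of $T\in\mathrm{SSYT}(\mu,d)$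 with $c(u)<\lambda_{d+1-T(u)}$ for all $u\in[\mu]$. - $\nabla_{\lambda/\mu}$ is the region whose left boundary has $d$ edges going up-left from its bottom left vertex; whose lower right boundary, from the same vertex, consists of $\lambda_d$ edges to the right, one edge up-right, $\lambda_{d-1}-\lambda_d$ edges to the right, one edge up-right, …, $\lambda_1-\lambda_2$ edges to the right, one edge up-right; and whose top boundary reads, from left to right, $\mu_d$ horizontal edges, a peak (an upward unit triangle), $\mu_{d-1}-\mu_d$ horizontal edges, a peak, …, $\mu_1-\mu_2$ horizontal edges, a peak, $\lambda_1-\mu_1$ horizontal edges. $L(\nabla_{\lambda/\mu})$ is its set of lozenge tilings, and $R_\leftarrow(\mathsf t)$ is the set of rhombi of $\mathsf t$ whose long diagonal runs NW–SE. The weight $w(r)$ of $r\in R_\leftarrow(\mathsf t)$ is the distance from the center of $r$ to the rightmost point of $\nabla_{\lambda/\mu}$ at the same height. - $w_\nu$ (for $\nu$ in the $a\times b$ box) is the $0/1$ word of length $a+b$ recording the boundary path of $[\nu]$ from the bottom left to the top right corner of the box, with $0$ for a vertical and $1$ for a horizontal step; equivalently, its zeros are at the positions $\nu_i+a-i+1$,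 $1\le i\le a$. - $\Delta^{\lambda\mu}_\lambda$ is the set of equivariant puzzles: fillings of the upward equilateral triangle of side $a+b$ by labeled pieces, with equal labels on common edges, such that the NW, NE and bottom sides read, from left to right, $w_\lambda$, $w_\mu$, $w_\lambda$. The pieces are unit triangles with all labels $0$, unit triangles with all labels $1$, the vertical rhombus with NW and SE sides labeled $1$ and NE and SW sides labeled $0$ (these three may be rotated), and the equivariant piece, which is the vertical rhombus with NW and SE sides labeled $0$ and NE and SW sides labeled $1$ (not to be rotated). No reflections are allowed. $\lozenge(P)$ is the set of equivariant pieces of $P$, and $\operatorname{ht}(p)$ is the distance from the center of $p$ to the bottom side, in units of the height of a unit triangle. **Theorem 1.6.** The Okounkov–Olshanski and Knutson–Tao formulas for $f^{\lambda/\mu}$ are term-by-term equivalent. Precisely, for $T\in\mathrm{SSYT}(\mu,d)$ the term $C\prod_{u\in[\mu]}(\lambda_{d+1-T(u)}-c(u))$ is nonzero if and only if $T\in\mathcal{OOT}(\lambda/\mu)$, and there are bijections $$\Phi:\mathcal{OOT}(\lambda/\mu)\to L(\nabla_{\lambda/\mu}),\qquad \Psi:L(\nabla_{\lambda/\mu})\to\Delta^{\lambda\mu}_\lambda$$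 such that 1. for every $T\in\mathcal{OOT}(\lambda/\mu)$ there is a bijection $\alpha:[\mu]\to R_\leftarrow(\Phi(T))$ such that, for every $u\in[\mu]$, $\alpha(u)$ lies in the $T(u)$-th row of $\nabla_{\lambda/\mu}$ from the bottom and $w(\alpha(u))=\lambda_{d+1-T(u)}-c(u)$; 2. for every $\mathsf t\in L(\nabla_{\lambda/\mu})$ there is a bijection $\beta:R_\leftarrow(\mathsf t)\to\lozenge(\Psi(\mathsf t))$ such that, for every $r\in R_\leftarrow(\mathsf t)$, $\operatorname{ht}(\beta(r))=w(r)$ and, if $r$ lies in the row of $\nabla_{\lambda/\mu}$ that is $i$-th from the top when peaks are not counted, $\beta(r)$ lies in the strip of the triangle, parallel to its NE side, that joins the edges at position $\lambda_i+a-i+1$ (the $i$-th zero of $w_\lambda$, counted from the right) of the NW side and of the bottom side; 3. corresponding terms are equal: for all $T\in\mathcal{OOT}(\lambda/\mu)$ and $\mathsf t\in L(\nabla_{\lambda/\mu})$, $$C\prod_{u\in[\mu]}\bigl(\lambda_{d+1-T(u)}-c(u)\bigr)=C\prod_{r\in R_\leftarrow(\Phi(T))}w(r),\qquad C\prod_{r\in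 R_\leftarrow(\mathsf t)}w(r)=C\prod_{p\in\lozenge(\Psi(\mathsf t))}\operatorname{ht}(p).$$ -/

import Mathlib

namespace OOKT

/-! ### Tableaux and the terms of the Okounkov–Olshanski formula

Cells are indexed from `0`, as in Mathlib: the cell `(i, j)` of a Young diagram lies in row `i`
(from the top) and column `j`; `lam.rowLen i` is the `(i+1)`-st part of the partition `lam`,
and `lam.colLen 0` is its length. -/

/-- The content of a cell. -/
def content (u : ℕ × ℕ) : ℤ := (u.2 : ℤ) - (u.1 : ℤ)

/-- The hook length of the cell `u` of `lam` (`λᵢ + λ'ⱼ - i - j + 1` for 1-based `i, j`). -/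
def hook (lam : YoungDiagram) (u : ℕ × ℕ) : ℤ :=
  (lam.rowLen u.1 : ℤ) + (lam.colLen u.2 : ℤ) - (u.1 : ℤ) - (u.2 : ℤ) - 1

/-- The common prefactor `|λ/μ|! / ∏ h(u)` of the formulas for the number of standard Young
tableaux of shape `λ/μ`. -/
def prefactor (lam mu : YoungDiagram) : ℚ :=
  (Nat.factorial (lam.card - mu.card) : ℚ) / ∏ u ∈ lam.cells, (hook lam u : ℚ)

/-- `SSYT(mu, d)`: semistandard tableaux of shape `mu` with entries in `{1, …, d}`. -/
def SSYTBounded (mu : YoungDiagram) (d : ℕ) : Type :=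
  {T : SemistandardYoungTableau mu // ∀ u ∈ mu.cells, 1 ≤ T u.1 u.2 ∧ T u.1 u.2 ≤ d}

/-- The weight `λ_{d+1-T(u)} - c(u)`, where `d` is the length of `lam`; the part of (1-based)
index `d + 1 - t` is `lam.rowLen (d - t)`. -/
def cellWeight (lam : YoungDiagram) {mu : YoungDiagram} (T : SemistandardYoungTableau mu)
    (u : ℕ × ℕ) : ℤ :=
  (lam.rowLen (lam.colLen 0 - T u.1 u.2) : ℤ) - content u

/-- The term of the Okounkov–Olshanski formula indexed by `T`. -/
def ooTerm (lam : YoungDiagram) {mu : YoungDiagram} (T : SemistandardYoungTableau mu) : ℚ :=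
  prefactor lam mu * ∏ u ∈ mu.cells, (cellWeight lam T u : ℚ)

/-- `T` satisfies `c(u) < λ_{d+1-T(u)}` for all cells `u`. -/
def IsOO (lam : YoungDiagram) {mu : YoungDiagram} (T : SemistandardYoungTableau mu) : Prop :=
  ∀ u ∈ mu.cells, content u < (lam.rowLen (lam.colLen 0 - T u.1 u.2) : ℤ)

/-- Okounkov–Olshanski tableaux of shape `lam / mu`. -/
def OOT (lam mu : YoungDiagram) : Type :=
  {T : SSYTBounded mu (lam.colLen 0) // IsOO lam T.1}

/-! ### The triangular lattice

The vertex `(x, y)` stands for the point `x (1, 0) + y (1/2, √3/2)` of the plane. -/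

/-- Unit triangles of the triangular lattice. -/
inductive Tri where
  /-- the triangle with vertices `(x, y)`, `(x+1, y)`, `(x, y+1)` -/
  | up (x y : ℤ)
  /-- the triangle with vertices `(x+1, y)`, `(x, y+1)`, `(x+1, y+1)` -/
  | down (x y : ℤ)
  deriving DecidableEq

/-- Unit edges of the triangular lattice. -/
inductive Edge where
  /-- the horizontal edge from `(x, y)` to `(x+1, y)` -/
  | horiz (x y : ℤ)
  /-- the edge from `(x, y)` to `(x, y+1)`, rising to the right -/
  | slash (x y : ℤ)
  /-- the edge from `(x+1, y)` to `(x, y+1)`, rising to the left -/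
  | back (x y : ℤ)
  deriving DecidableEq

/-- Orientations of a rhombus, named by its longer diagonal. -/
inductive Dir where
  | vertical
  | nwse
  | nesw
  deriving DecidableEq

/-- The two triangles of the rhombus of orientation `o` whose upward triangle is `up x y`. -/
def rhombusCells (o : Dir) (x y : ℤ) : Set Tri :=
  match o with
  | .vertical => {Tri.up x y, Tri.down x (y - 1)}
  | .nwse => {Tri.up x y, Tri.down (x - 1) y}
  | .nesw => {Tri.up x y, Tri.down x y}

/-- A lozenge, given by its orientation and the position of its upward triangle `up x y`. -/
structure Lozenge where
  dir : Dir
  x : ℤ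
  y : ℤ
  deriving DecidableEq

/-- The unit triangles covered by a lozenge. -/
def Lozenge.cells (l : Lozenge) : Set Tri := rhombusCells l.dir l.x l.y

/-- Lozenge tilings of a region of the triangular lattice. -/
structure LozengeTiling (R : Set Tri) where
  lozenges : Finset Lozenge
  subset : ∀ l ∈ lozenges, l.cells ⊆ R
  cover : ∀ t ∈ R, ∃! l, l ∈ lozenges ∧ t ∈ l.cells

/-! ### The region `∇` and the weights of its tilings -/

/-- The (0-based) index, counted from the top, of the row between heights `y` and `y + 1` in a
region with `lam.colLen 0` rows, the lowest one being at `y = 0`. -/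
def rowFromTop (lam : YoungDiagram) (y : ℤ) : ℕ := lam.colLen 0 - 1 - y.toNat

/-- The right boundary of the region `∇` in the row between heights `y` and `y + 1` is the edge
from `(rightEnd lam y, y)` to `(rightEnd lam y, y + 1)`. -/
def rightEnd (lam : YoungDiagram) (y : ℤ) : ℤ := (lam.rowLen (rowFromTop lam y) : ℤ)

/-- The region `∇` of `lam / mu`. Let `d` be the length of `lam`. From the bottom left vertex
`(0, 0)` the left boundary goes `d` steps up-left to `(-d, d)`; the lower right boundary consists of
`λ_d` steps to the right, one step up-right, `λ_{d-1} - λ_d` steps to the right, one step up-right,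
and so on, ending at `(λ₁, d)`; the top boundary reads, from left to right, `μ_d` horizontal
steps, a peak (an upward unit triangle above height `d`), `μ_{d-1} - μ_d` horizontal steps, a peak,
…, a peak, `λ₁ - μ₁` horizontal steps. -/
def nabla (lam mu : YoungDiagram) : Set Tri :=
  {t | match t with
    | .up x y =>
        (0 ≤ y ∧ y < (lam.colLen 0 : ℤ) ∧ -y ≤ x ∧ x < rightEnd lam y) ∨
        (y = (lam.colLen 0 : ℤ) ∧
          ∃ i : ℕ, i < lam.colLen 0 ∧ x = (mu.rowLen i : ℤ) - ((i : ℤ) + 1))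
    | .down x y =>
        0 ≤ y ∧ y < (lam.colLen 0 : ℤ) ∧ -y - 1 ≤ x ∧ x < rightEnd lam y}

/-- The NW-SE rhombi of a tiling. -/
def nwseRhombi {R : Set Tri} (t : LozengeTiling R) : Finset Lozenge :=
  t.lozenges.filter (fun l => l.dir = Dir.nwse)

/-- The distance from the center of an NW-SE rhombus `r` to the rightmost point of `∇` at the same
height. The center of `r` is the midpoint of the edge from `(r.x, r.y)` to `(r.x, r.y + 1)`. -/
def rhombusWeight (lam : YoungDiagram) (r : Lozenge) : ℤ := rightEnd lam r.y - r.x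

/-- The term of the lozenge tiling formula indexed by `t`. -/
def tilingTerm (lam mu : YoungDiagram) (t : LozengeTiling (nabla lam mu)) : ℚ :=
  prefactor lam mu * ∏ r ∈ nwseRhombi t, (rhombusWeight lam r : ℚ)

/-! ### Equivariant Knutson–Tao puzzles -/

/-- Follow the boundary of `m`, inside a rectangle with `a` rows, from the bottom left to the top
right corner. The vertical step along row `i` (0-based) is preceded by `m.rowLen i` horizontal and
`a - 1 - i` vertical steps, so that this is its (0-based) position on the path. -/
def zeroPos (a : ℕ) (m : YoungDiagram) (i : ℕ) : ℕ := m.rowLen i + (a - 1 - i)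

/-- The `k`-th letter (0-based) of the word of `m` in a rectangle with `a` rows: `0` for a vertical
step and `1` for a horizontal step of the boundary path. -/
def word (a : ℕ) (m : YoungDiagram) (k : ℕ) : Fin 2 :=
  if ∃ i ∈ Finset.range a, k = zeroPos a m i then 0 else 1

/-- The kinds of puzzle pieces. -/
inductive PieceKind where
  /-- upward triangle with all sides labeled `l` -/
  | upTri (l : Fin 2)
  /-- downward triangle with all sides labeled `l` -/
  | downTri (l : Fin 2)
  /-- non-equivariant rhombus -/
  | rhombus (o : Dir)
  /-- equivariant piece, a vertical rhombus that may not be rotated -/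
  | equivariant
  deriving DecidableEq

/-- A placed puzzle piece. A triangle is `up x y` or `down x y`; for a rhombus, `up x y` is its
upward triangle. -/
structure PuzzlePiece where
  kind : PieceKind
  x : ℤ
  y : ℤ
  deriving DecidableEq

/-- The unit triangles covered by a puzzle piece. -/
def PuzzlePiece.cells (p : PuzzlePiece) : Set Tri :=
  match p.kind with
  | .upTri _ => {Tri.up p.x p.y}
  | .downTri _ => {Tri.down p.x p.y}
  | .rhombus o => rhombusCells o p.x p.y
  | .equivariant => rhombusCells .vertical p.x p.y

/-- The sides of a puzzle piece, with their labels. The vertical non-equivariant rhombus has label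
`1` on its NW and SE sides and `0` on its NE and SW sides, and the two other non-equivariant rhombi
are its rotations; the equivariant piece has `0` on its NW and SE sides and `1` on its NE and SW
sides. -/
def PuzzlePiece.sides (p : PuzzlePiece) : List (Edge × Fin 2) :=
  match p.kind with
  | .upTri l => [(.horiz p.x p.y, l), (.slash p.x p.y, l), (.back p.x p.y, l)]
  | .downTri l => [(.horiz p.x (p.y + 1), l), (.slash (p.x + 1) p.y, l), (.back p.x p.y, l)]
  | .rhombus .vertical =>
      [(.slash p.x p.y, 1), (.slash (p.x + 1) (p.y - 1), 1),
        (.back p.x p.y, 0), (.back p.x (p.y - 1), 0)]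
  | .rhombus .nwse =>
      [(.back (p.x - 1) p.y, 1), (.back p.x p.y, 1),
        (.horiz p.x p.y, 0), (.horiz (p.x - 1) (p.y + 1), 0)]
  | .rhombus .nesw =>
      [(.horiz p.x p.y, 1), (.horiz p.x (p.y + 1), 1),
        (.slash p.x p.y, 0), (.slash (p.x + 1) p.y, 0)]
  | .equivariant =>
      [(.slash p.x p.y, 0), (.slash (p.x + 1) (p.y - 1), 0),
        (.back p.x p.y, 1), (.back p.x (p.y - 1), 1)]

/-- The upward equilateral triangle of side length `n` with bottom left vertex `(0, 0)`. -/
def bigTriangle (n : ℕ) : Set Tri :=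
  {t | match t with
    | .up x y => 0 ≤ x ∧ 0 ≤ y ∧ x + y + 1 ≤ (n : ℤ)
    | .down x y => 0 ≤ x ∧ 0 ≤ y ∧ x + y + 2 ≤ (n : ℤ)}

/-- Equivariant puzzles for partitions in an `a × b` rectangle: fillings of the triangle of side
length `a + b` by puzzle pieces such that labels agree on common sides and the NW side, the NE side
and the bottom side read, from left to right, the words of `m₁`, `m₂` and `m₃`. -/
structure Puzzle (a b : ℕ) (m₁ m₂ m₃ : YoungDiagram) where
  pieces : Finset PuzzlePiece
  subset : ∀ p ∈ pieces, p.cells ⊆ bigTriangle (a + b)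
  cover : ∀ t ∈ bigTriangle (a + b), ∃! p, p ∈ pieces ∧ t ∈ p.cells
  matching : ∀ p ∈ pieces, ∀ q ∈ pieces, ∀ (e : Edge) (l l' : Fin 2),
    (e, l) ∈ p.sides → (e, l') ∈ q.sides → l = l'
  northwest : ∀ p ∈ pieces, ∀ (k : ℕ) (l : Fin 2), k < a + b →
    (Edge.slash 0 (k : ℤ), l) ∈ p.sides → l = word a m₁ k
  northeast : ∀ p ∈ pieces, ∀ (k : ℕ) (l : Fin 2), k < a + b →
    (Edge.back (k : ℤ) ((a : ℤ) + (b : ℤ) - 1 - (k : ℤ)), l) ∈ p.sides → l = word a m₂ k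
  bottom : ∀ p ∈ pieces, ∀ (k : ℕ) (l : Fin 2), k < a + b →
    (Edge.horiz (k : ℤ) 0, l) ∈ p.sides → l = word a m₃ k

/-- The equivariant pieces of a puzzle. -/
def equivariantPieces {a b : ℕ} {m₁ m₂ m₃ : YoungDiagram} (P : Puzzle a b m₁ m₂ m₃) :
    Finset PuzzlePiece :=
  P.pieces.filter (fun p => p.kind = PieceKind.equivariant)

/-- The height of an equivariant piece: the distance of its center to the bottom edge, in units of
the height of a unit triangle. The center is the midpoint of the edge from `(p.x, p.y)` to
`(p.x + 1, p.y)`. -/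
def height (p : PuzzlePiece) : ℤ := p.y

/-- The (0-based) index of the strip, parallel to the NE side of the triangle, in which a vertical
rhombus lies: strip `k` consists of the points of the triangle with `k ≤ x + y ≤ k + 1`; it runs
from the `k`-th edge of the NW side to the `k`-th edge of the bottom side. -/
def strip (p : PuzzlePiece) : ℤ := p.x + p.y

/-- The term of the Knutson–Tao formula for `lam / mu` indexed by the puzzle `P`. -/
def puzzleTerm {a b : ℕ} (lam mu : YoungDiagram) (P : Puzzle a b lam mu lam) : ℚ :=
  prefactor lam mu * ∏ p ∈ equivariantPieces P, (height p : ℚ)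

end OOKT

namespace OOKT

/-! All three families encode the same integer array. A tableau of shape `mu` is a chain of shapes,
the `y`-th formed by the entries at most `y`, with consecutive shapes differing by horizontal
strips. Let `H(x, y)` count the beads of the `y`-th shape at positions at least `x`.
Semistandardness becomes `H(x+1, y) ≤ H(x, y) ≤ H(x, y+1) ≤ H(x+1, y) + 1`, and the
Okounkov–Olshanski condition says that `H(·, y+1)` vanishes from position `lam.rowLen (d - 1 - y)`
on. A cell of content `x` and entry `y + 1` is an increment `H(x, y+1) = H(x, y) + 1`
(`entry_spec`).

Tilings: the three gaps in the displayed chain are nonnegative integers with sum 1, so exactly one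
of them is 1, and it selects the lozenge covering the upward triangle at `(x, y)`; the chain `H(x+1,
y) ≤ H(x+1, y+1) ≤ H(x, y+1) ≤ H(x+1, y) + 1` does the same for downward triangles
(`existsUnique_isLozenge`). NW-SE rhombi are the increments. Conversely, vertical lozenges give
beads and NW-SE rhombi give increments, and these data rebuild `H` (`exists_of_rows`).

Puzzles: equality of the NW and bottom words excludes one orientation of rhombus (`nesw_notMem`), so
each strip parallel to the NE side carries a single letter (`isOne_iff`). A strip of letter `1`
copies the labels of its left line to its right line. The strips of letter `0` are the rows of the
tiling, sheared, and the equivariant pieces in them are again the increments; the NE side displays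
the beads of `mu`. If `a` exceeds the length of `lam`, the additional rows are frozen (`shift`).

In all three models an increment at `(x, y)` has weight `lam.rowLen (d - 1 - y) - x`, so the
products agree factor by factor. -/

/-- The positions `m_i - i - 1` (`i` counted from `0`) of the beads of `m`. -/
def IsBead (m : YoungDiagram) (x : ℤ) : Prop := ∃ i : ℕ, x = (m.rowLen i : ℤ) - i - 1

/-- Height functions with `d` rows. The value at `(x, y)` is the number of beads at or to the right
of `x` of the shape formed by the entries at most `y` of a tableau of shape `mu`. -/
@[ext]
structure HeightFunction (lam mu : YoungDiagram) (d : ℕ) where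
  val : ℤ → ℕ → ℕ
  val_zero : ∀ x, val x 0 = (-x).toNat
  lt_val_iff : ∀ x y, d ≤ y → ∀ i : ℕ, i < val x y ↔ (i : ℤ) + x < mu.rowLen i
  val_add_one_le : ∀ x y, val (x + 1) y ≤ val x y
  le_val_succ : ∀ x y, val x y ≤ val x (y + 1)
  val_succ_le : ∀ x y, val x (y + 1) ≤ val (x + 1) y + 1
  val_succ_eq_zero : ∀ x y, y < d → (lam.rowLen (d - 1 - y) : ℤ) ≤ x → val x (y + 1) = 0

/-! ### Height functions: frozen zones, extensionality, reconstruction from rows -/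

namespace HeightFunction

variable {lam mu : YoungDiagram} {d : ℕ} (H : HeightFunction lam mu d)

lemma val_succ_le_val (x : ℤ) (y : ℕ) : H.val x (y + 1) ≤ H.val x y + 1 := by
  have := H.val_succ_le x y
  have := H.val_add_one_le x y
  omega

lemma val_le (x : ℤ) (y : ℕ) : H.val x y ≤ H.val (x + 1) y + 1 := by
  have := H.val_succ_le x y
  have := H.le_val_succ x y
  omega

lemma val_mono (x : ℤ) : Monotone (H.val x) := monotone_nat_of_le_succ (H.le_val_succ x)

lemma toNat_neg_le (x : ℤ) (y : ℕ) : (-x).toNat ≤ H.val x y := by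
  rw [← H.val_zero]
  exact H.val_mono x (Nat.zero_le y)

/-- A shape with entries at most `y` has at most `y` rows, so every position left of `-y` holds a
bead. In terms of heights, the interlacing bound carries the value down from `(x + 1, y)`. This is
the left boundary of `∇`. -/
lemma val_of_le_neg (x : ℤ) (y : ℕ) (h : x ≤ -y) : H.val x y = (-x).toNat := by
  induction y generalizing x with
  | zero => exact H.val_zero x
  | succ y ih =>
    have h1 := ih (x + 1) (by push_cast at h; omega)
    have h2 := H.val_succ_le x y
    have h3 := H.toNat_neg_le x (y + 1)
    push_cast at h
    omega

lemma val_eq_zero {x : ℤ} {y : ℕ} (hy : y < d) (hx : (lam.rowLen (d - 1 - y) : ℤ) ≤ x) :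
    H.val x y = 0 := by
  have := H.val_succ_eq_zero x y hy hx
  have := H.le_val_succ x y
  omega

/-- Increments are confined between the frozen zone on the left and the zero zone on the right. The
right bound is the inequality `c(u) < λ_{d+1-T(u)}`, obtained for all cells although the structure
only imposes vanishing. -/
lemma step_bounds {x : ℤ} {y : ℕ} (hy : y < d) (h : H.val x (y + 1) = H.val x y + 1) :
    -(y : ℤ) ≤ x ∧ x < lam.rowLen (d - 1 - y) := by
  constructor
  · by_contra hx
    have h1 := H.val_of_le_neg x y (by omega)
    have h2 := H.val_of_le_neg x (y + 1) (by push_cast; omega)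
    omega
  · by_contra hx
    have h1 := H.val_succ_eq_zero x y hy (by omega)
    omega

lemma lt_rowLen_of_lt {x : ℤ} {y i : ℕ} (h : i < H.val x y) : (i : ℤ) + x < mu.rowLen i := by
  have h1 := H.val_mono x (le_max_left y d)
  exact (H.lt_val_iff x (max y d) (le_max_right _ _) i).1 (by omega)

lemma val_of_isBead {x : ℤ} {y : ℕ} (hy : d ≤ y) (h : IsBead mu x) :
    H.val x y = H.val (x + 1) y + 1 := by
  obtain ⟨i, hi⟩ := h
  have h1 := (H.lt_val_iff x y hy i).2 (by omega)
  have h2 := mt (H.lt_val_iff (x + 1) y hy i).1 (by omega)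
  have h3 := H.val_le x y
  omega

lemma isBead_of_val {x : ℤ} {y : ℕ} (hy : d ≤ y) (h : H.val x y = H.val (x + 1) y + 1) :
    IsBead mu x := by
  refine ⟨H.val (x + 1) y, ?_⟩
  have h1 := (H.lt_val_iff x y hy (H.val (x + 1) y)).1 (by omega)
  have h2 := mt (H.lt_val_iff (x + 1) y hy (H.val (x + 1) y)).2 (by omega)
  omega

lemma ext_top {H K : HeightFunction lam mu d} (h : ∀ x y, y < d → H.val x y = K.val x y) :
    H = K := by
  ext x y
  by_cases hy : y < d
  · exact h x y hy
  · refine eq_of_forall_lt_iff fun i => ?_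
    rw [H.lt_val_iff x y (by omega), K.lt_val_iff x y (by omega)]

/-- The bottom row is fixed and each row rises by 0 or 1 at every position. Hence injectivity for
tilings and puzzles can be tested on NW-SE rhombi and equivariant pieces alone. -/
lemma ext_of_step {H K : HeightFunction lam mu d}
    (h : ∀ x y, y < d → (H.val x (y + 1) = H.val x y + 1 ↔ K.val x (y + 1) = K.val x y + 1)) :
    H = K := by
  refine ext_top fun x y hy => ?_
  induction y with
  | zero => rw [H.val_zero, K.val_zero]
  | succ y ih =>
    have h1 := ih (by omega)
    have h2 := h x y (by omega)
    have := H.val_succ_le_val x y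
    have := K.val_succ_le_val x y
    have := H.le_val_succ x y
    have := K.le_val_succ x y
    omega

/-- The lowest `m` rows belong to zero parts of `lam`, so their right bound is 0, which meets the
frozen left zone and leaves no freedom. -/
lemma val_of_le {m : ℕ} (hd : lam.colLen 0 ≤ d) (K : HeightFunction lam mu (d + m)) (x : ℤ)
    (y : ℕ) (hy : y ≤ m) : K.val x y = (-x).toNat := by
  induction y generalizing x with
  | zero => exact K.val_zero x
  | succ y ih =>
    have h1 := ih (x + 1) (by omega)
    have h2 := K.val_succ_le x y
    have h3 := K.toNat_neg_le x (y + 1)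
    by_cases hx : 0 ≤ x
    · have h4 : lam.rowLen (d + m - 1 - y) = 0 := by
        by_contra h0
        have h5 : (d + m - 1 - y, 0) ∈ lam := YoungDiagram.mem_iff_lt_rowLen.2 (by omega)
        have := YoungDiagram.mem_iff_lt_colLen.1 h5
        omega
      have := K.val_succ_eq_zero x y (by omega) (by omega)
      omega
    · omega

/-- Prepending `m` empty rows. -/
def shift (hd : lam.colLen 0 ≤ d) (m : ℕ) :
    HeightFunction lam mu d ≃ HeightFunction lam mu (d + m) where
  toFun H :=
    { val := fun x y => H.val x (y - m)
      val_zero := fun x => by simpa using H.val_zero x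
      lt_val_iff := fun x y hy => H.lt_val_iff x _ (by omega)
      val_add_one_le := fun x y => H.val_add_one_le x _
      le_val_succ := fun x y => H.val_mono x (by omega)
      val_succ_le := fun x y => by
        by_cases h : m ≤ y
        · rw [Nat.sub_add_comm h]
          exact H.val_succ_le x _
        -- Truncated subtraction sends all rows below `m` to row 0, where the heights are explicit.
        · have h1 : y + 1 - m = 0 := by omega
          have h2 : y - m = 0 := by omega
          rw [h1, h2, H.val_zero, H.val_zero]
          omega
      val_succ_eq_zero := fun x y hy hx => by
        by_cases h : m ≤ y
        · rw [Nat.sub_add_comm h]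
          refine H.val_succ_eq_zero x _ (by omega) ?_
          rwa [show d - 1 - (y - m) = d + m - 1 - y by omega]
        · rw [show y + 1 - m = 0 by omega, H.val_zero]
          omega }
  invFun K :=
    { val := fun x y => K.val x (y + m)
      val_zero := fun x => K.val_of_le hd x _ (by omega)
      lt_val_iff := fun x y hy => K.lt_val_iff x _ (by omega)
      val_add_one_le := fun x y => K.val_add_one_le x _
      le_val_succ := fun x y => K.val_mono x (by omega)
      val_succ_le := fun x y => by
        rw [Nat.add_right_comm]
        exact K.val_succ_le x _
      val_succ_eq_zero := fun x y hy hx => by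
        rw [Nat.add_right_comm]
        refine K.val_succ_eq_zero x _ (by omega) ?_
        rwa [show d + m - 1 - (y + m) = d - 1 - y by omega] }
  left_inv H := by
    ext x y
    simp
  right_inv K := by
    ext x y
    by_cases h : m ≤ y
    · simp [Nat.sub_add_cancel h]
    · simp only [show y - m = 0 by omega, zero_add]
      rw [K.val_of_le hd x m le_rfl, K.val_of_le hd x y (by omega)]

lemma shift_val (hd : lam.colLen 0 ≤ d) (m : ℕ) (x : ℤ) (y : ℕ) :
    (shift hd m H).val x y = H.val x (y - m) := rfl

/-- A function on `ℤ` that jumps exactly at the beads of `mu` counts beads. -/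
lemma lt_iff_of_beads {f : ℤ → ℕ} (h0 : ∃ B, ∀ x, B ≤ x → f x = 0)
    (hb : ∀ x, IsBead mu x → f x = f (x + 1) + 1) (hn : ∀ x, ¬ IsBead mu x → f x = f (x + 1))
    (x : ℤ) (i : ℕ) : i < f x ↔ (i : ℤ) + x < mu.rowLen i := by
  obtain ⟨B, hB⟩ := h0
  have anti : ∀ {i j : ℕ}, i ≤ j → mu.rowLen j ≤ mu.rowLen i := fun h => mu.rowLen_anti _ _ h
  rcases le_total (max B (mu.rowLen 0)) x with h | h
  · rw [hB x (le_trans (le_max_left _ _) h)]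
    have h1 := le_trans (le_max_right _ _) h
    have h2 := anti (Nat.zero_le i)
    omega
  · induction x, h using Int.leInductionDown generalizing i with
    | base =>
      rw [hB _ (le_max_left _ _)]
      have h1 := le_max_right B (mu.rowLen 0 : ℤ)
      have h2 := anti (Nat.zero_le i)
      omega
    | pred x _ ih =>
      by_cases hx : IsBead mu (x - 1)
      · rw [hb _ hx, sub_add_cancel]
        obtain ⟨k, hk⟩ := hx
        -- The bead at `x - 1` has index `k`, so exactly the beads of indices `0, …, k - 1` lie to
        -- its right; the induction hypothesis at `k` and `k - 1` pins down the count.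
        have h1 : f x = k := by
          have h2 := mt (ih k).1 (by omega)
          rcases Nat.eq_zero_or_pos k with h3 | h3
          · omega
          · have h4 := (ih (k - 1)).2 (by
              have := anti (show k - 1 ≤ k by omega)
              omega)
            omega
        rw [h1]
        rcases Nat.lt_or_ge k i with h3 | h3
        · have := anti (show k ≤ i by omega)
          omega
        · have := anti h3
          omega
      · rw [hn _ hx, sub_add_cancel]
        have := ih i
        have : x - 1 ≠ (mu.rowLen i : ℤ) - i - 1 := fun h => hx ⟨i, h⟩
        omega

/-- Height functions from the beads `z` of the rows and the increments `e` between them. -/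
lemma exists_of_rows {z e : ℤ → ℕ → ℕ}
    (z_zero : ∀ x, z x 0 = if x < 0 then 1 else 0)
    (z_bead : ∀ x, IsBead mu x → z x d = 1) (z_not_bead : ∀ x, ¬ IsBead mu x → z x d = 0)
    (row : ∀ x y, y < d → z x (y + 1) + e (x + 1) y = z x y + e x y)
    (excl : ∀ x y, y < d → e (x + 1) y + z x (y + 1) ≤ 1)
    (e_zero : ∀ x y, y < d → (lam.rowLen (d - 1 - y) : ℤ) ≤ x → e x y = 0) :
    ∃ H : HeightFunction lam mu d,
      (∀ x y, y ≤ d → H.val x y = H.val (x + 1) y + z x y) ∧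
      (∀ x y, y < d → H.val x (y + 1) = H.val x y + e x y) := by
  -- Heights are the heights of the empty shape plus the accumulated increments; `min y d` keeps
  -- them constant above row `d`.
  set f : ℤ → ℕ → ℕ := fun x y => (-x).toNat + ∑ j ∈ Finset.range (min y d), e x j with hf
  have f_succ : ∀ x y, y < d → f x (y + 1) = f x y + e x y := by
    intro x y hy
    simp only [hf, min_eq_left (show y + 1 ≤ d by omega), min_eq_left hy.le,
      Finset.sum_range_succ]
    omega
  have f_zero : ∀ x, f x 0 = (-x).toNat := fun x => by simp [hf]
  have f_top : ∀ x y, d ≤ y → f x y = f x d := fun x y hy => by simp [hf, min_eq_right hy]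
  have f_row : ∀ x y, y ≤ d → f x y = f (x + 1) y + z x y := by
    intro x y hy
    induction y with
    | zero =>
      rw [f_zero, f_zero, z_zero]
      split_ifs <;> omega
    | succ y ih =>
      have h1 := row x y (by omega)
      have h2 := ih (by omega)
      rw [f_succ x y (by omega), f_succ (x + 1) y (by omega)]
      omega
  -- The right bounds grow with `y`, so beyond the bound of one row all earlier increments vanish as
  -- well.
  have f_van : ∀ x y, y ≤ d → (lam.rowLen (d - y) : ℤ) ≤ x → f x y = 0 := by
    intro x y hy hx
    induction y with
    | zero => rw [f_zero]; omega
    | succ y ih =>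
      rw [f_succ x y (by omega), e_zero x y (by omega) (by rwa [Nat.sub_sub, add_comm 1 y]),
        ih (by omega)]
      have := lam.rowLen_anti (d - (y + 1)) (d - y) (by omega)
      omega
  have f_lt : ∀ x (i : ℕ), i < f x d ↔ (i : ℤ) + x < mu.rowLen i :=
    lt_iff_of_beads ⟨_, fun x hx => f_van x d le_rfl hx⟩
      (fun x hx => by rw [f_row x d le_rfl, z_bead x hx])
      (fun x hx => by rw [f_row x d le_rfl, z_not_bead x hx, add_zero])
  refine ⟨⟨f, f_zero, fun x y hy i => by rw [f_top x y hy, f_lt], fun x y => ?_, fun x y => ?_,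
    fun x y => ?_, fun x y hy hx => f_van x (y + 1) (by omega) ?_⟩, f_row, f_succ⟩
  · rcases le_total d y with h | h
    · rw [f_top x y h, f_top _ y h, f_row x d le_rfl]
      omega
    · rw [f_row x y h]
      omega
  · rcases Nat.lt_or_ge y d with h | h
    · rw [f_succ x y h]
      omega
    · rw [f_top x y h, f_top x (y + 1) (by omega)]
  -- Interlacing: `f x (y+1)` exceeds `f (x+1) y` by `z x (y+1) + e (x+1) y`, which `excl` bounds by
  -- 1.
  · rcases Nat.lt_or_ge y d with h | h
    · have := excl x y h
      rw [f_row x (y + 1) h, f_succ _ y h]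
      omega
    · rw [f_top _ y h, f_top x (y + 1) (by omega), f_row x d le_rfl]
      by_cases hx : IsBead mu x
      · rw [z_bead x hx]
      · rw [z_not_bead x hx]; omega
  · rwa [show d - (y + 1) = d - 1 - y by omega]

end HeightFunction

/-! ### From height functions to tableaux -/

namespace HeightFunction

variable {lam mu : YoungDiagram} {d : ℕ} (H : HeightFunction lam mu d)

lemma val_anti (y : ℕ) : Antitone fun x => H.val x y :=
  antitone_int_of_succ_le fun x => H.val_add_one_le x y

lemma val_le_add (x : ℤ) (y n : ℕ) : H.val x y ≤ H.val (x + n) y + n := by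
  induction n with
  | zero => simp
  | succ n ih =>
    have := H.val_le (x + n) y
    rw [show x + ((n + 1 : ℕ) : ℤ) = x + n + 1 by push_cast; ring]
    omega

/-- The entries of the tableau of a height function. -/
noncomputable def entry (i j : ℕ) : ℕ := sInf {y | i < H.val (j - i) y}

/-- Heights increase with `y`, so the set whose infimum defines the entry is an upper set. The order
properties of the tableau are read off from this equivalence. -/
lemma entry_le_iff {i j : ℕ} (h : j < mu.rowLen i) (y : ℕ) :
    H.entry i j ≤ y ↔ i < H.val (j - i) y := by
  have hne : {y | i < H.val (j - i) y}.Nonempty :=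
    ⟨d, (H.lt_val_iff _ d le_rfl i).2 (by omega)⟩
  refine ⟨fun hy => lt_of_lt_of_le (show i < H.val (j - i) _ from Nat.sInf_mem hne)
    (H.val_mono _ hy), fun hy => Nat.sInf_le hy⟩

/-- Outside the diagram the defining set is empty, and the infimum of the empty set of naturals is
the required default value 0. -/
lemma entry_of_notMem {i j : ℕ} (h : ¬ j < mu.rowLen i) : H.entry i j = 0 := by
  rw [entry, Nat.sInf_eq_zero]
  right
  ext y
  have := mt (H.lt_rowLen_of_lt (x := j - i) (y := y) (i := i)) (by omega)
  simpa using this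

lemma entry_pos {i j : ℕ} (h : j < mu.rowLen i) : 1 ≤ H.entry i j := by
  by_contra h0
  have h1 := (H.entry_le_iff h 0).1 (by omega)
  rw [H.val_zero] at h1
  omega

lemma entry_le {i j : ℕ} (h : j < mu.rowLen i) : H.entry i j ≤ d :=
  (H.entry_le_iff h d).2 ((H.lt_val_iff _ d le_rfl i).2 (by omega))

lemma entry_row {i j k : ℕ} (hjk : j ≤ k) (h : k < mu.rowLen i) : H.entry i j ≤ H.entry i k := by
  have h1 := (H.entry_le_iff h _).1 le_rfl
  exact (H.entry_le_iff (by omega) _).2 (lt_of_lt_of_le h1 (H.val_anti _ (by simpa using hjk)))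

/-- If the lower entry is `y + 1`, interlacing puts more than `k - 1` beads at or right of `j - k +
1` in row `y`. Moving right by `k - 1 - i` loses at most one bead per step, so more than `i` remain
at `j - i`. -/
lemma entry_col {i k j : ℕ} (hik : i < k) (h : j < mu.rowLen k) : H.entry i j < H.entry k j := by
  have h1 := (H.entry_le_iff h _).1 le_rfl
  have h2 := H.entry_pos h
  obtain ⟨y, hy⟩ : ∃ y, H.entry k j = y + 1 := ⟨_, (Nat.sub_add_cancel h2).symm⟩
  have h3 := mu.rowLen_anti i k hik.le
  rw [hy] at h1 ⊢
  rw [Nat.lt_succ_iff, H.entry_le_iff (by omega)]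
  have h4 := H.val_succ_le (j - k) y
  have h5 := H.val_le_add (j - k + 1) y (k - 1 - i)
  rw [show (j - k + 1 + (k - 1 - i : ℕ) : ℤ) = j - i by omega] at h5
  omega

/-- An entry of the tableau records the row in which the height function increases. -/
lemma entry_spec {i j : ℕ} (h : j < mu.rowLen i) :
    ∃ y, y < d ∧ H.entry i j = y + 1 ∧ H.val (j - i) y = i ∧ H.val (j - i) (y + 1) = i + 1 := by
  have h2 := H.entry_pos h
  have h3 := H.entry_le h
  obtain ⟨y, hy⟩ : ∃ y, H.entry i j = y + 1 := ⟨_, (Nat.sub_add_cancel h2).symm⟩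
  have h4 := (H.entry_le_iff h (y + 1)).1 (by omega)
  have h5 := mt (H.entry_le_iff h y).2 (by omega)
  have h6 := H.val_succ_le_val (j - i) y
  exact ⟨y, by omega, hy, by omega, by omega⟩

/-- The semistandard tableau of a height function. -/
noncomputable def toTableau : SemistandardYoungTableau mu where
  entry := H.entry
  row_weak' := fun h1 h2 => H.entry_row h1.le (YoungDiagram.mem_iff_lt_rowLen.1 h2)
  col_strict' := fun h1 h2 => H.entry_col h1 (YoungDiagram.mem_iff_lt_rowLen.1 h2)
  zeros' := fun h => H.entry_of_notMem (mt YoungDiagram.mem_iff_lt_rowLen.2 h)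

lemma toTableau_apply (i j : ℕ) : H.toTableau i j = H.entry i j := rfl

lemma mem_cells_iff {u : ℕ × ℕ} : u ∈ mu.cells ↔ u.2 < mu.rowLen u.1 := by
  rw [YoungDiagram.mem_cells]
  exact YoungDiagram.mem_iff_lt_rowLen

/-- The Okounkov–Olshanski tableau of a height function. -/
noncomputable def toOOT (H : HeightFunction lam mu (lam.colLen 0)) : OOT lam mu :=
  ⟨⟨H.toTableau, fun _ hu => ⟨H.entry_pos (mem_cells_iff.1 hu), H.entry_le (mem_cells_iff.1 hu)⟩⟩,
    fun u hu => by
      obtain ⟨y, hy, h1, h2, h3⟩ := H.entry_spec (mem_cells_iff.1 hu)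
      have h4 := H.step_bounds hy (h3.trans (by rw [h2]))
      simp only [toTableau_apply, h1, content, ← Nat.sub_sub]
      rw [Nat.sub_right_comm]
      exact h4.2⟩

lemma toOOT_apply (H : HeightFunction lam mu (lam.colLen 0)) (i j : ℕ) :
    H.toOOT.1.1 i j = H.entry i j := rfl

/-- For `i + x < 0` the inequality `i < H(x, y)` always holds; otherwise it says that the cell `(i,
i + x)` has an entry at most `y`. The entries thus determine all heights. -/
lemma toOOT_injective : Function.Injective (toOOT (lam := lam) (mu := mu)) := by
  intro H K h
  have h1 : ∀ i j, H.entry i j = K.entry i j := fun i j => by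
    rw [← toOOT_apply, ← toOOT_apply, h]
  have key : ∀ (H K : HeightFunction lam mu (lam.colLen 0)), (∀ i j, H.entry i j = K.entry i j) →
      ∀ x y i, i < H.val x y → i < K.val x y := by
    intro H K h x y i hi
    rcases lt_or_ge ((i : ℤ) + x) 0 with h0 | h0
    · have := K.toNat_neg_le x y
      omega
    · obtain ⟨j, hj⟩ := Int.eq_ofNat_of_zero_le h0
      obtain rfl : x = j - i := by omega
      have hm : j < mu.rowLen i := by
        have := H.lt_rowLen_of_lt hi
        omega
      rwa [← K.entry_le_iff hm, ← h, H.entry_le_iff hm]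
  ext x y
  exact eq_of_forall_lt_iff fun i =>
    ⟨key H K h1 x y i, key K H (fun i j => (h1 i j).symm) x y i⟩

end HeightFunction

/-! ### From tableaux to height functions -/

section ofTableau

variable {lam mu : YoungDiagram} (T : SemistandardYoungTableau mu)

/-- The cell `(i, i + x)` has an entry at most `y`, where cells to the left of the diagram count as
filled and the other cells outside of the diagram do not. -/
def FilledBy (x : ℤ) (y i : ℕ) : Prop :=
  (i : ℤ) + x < 0 ∨ ((i : ℤ) + x < mu.rowLen i ∧ T i (i + x).toNat ≤ y)

variable {T}

/-- Going up a diagonal decreases entries: first left along row `i`, then up a column. The filled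
indices therefore form an initial segment, whose length can be taken as an infimum of the
complement. -/
lemma FilledBy.of_le {x : ℤ} {y i k : ℕ} (hik : i ≤ k) (h : FilledBy T x y k) :
    FilledBy T x y i := by
  rcases Nat.eq_or_lt_of_le hik with rfl | hik
  · exact h
  rcases lt_or_ge ((i : ℤ) + x) 0 with h0 | h0
  · exact Or.inl h0
  rcases h with h | ⟨h1, h2⟩
  · left; omega
  · have h3 := mu.rowLen_anti i k hik.le
    have h4 : (k, ((k : ℤ) + x).toNat) ∈ mu := YoungDiagram.mem_iff_lt_rowLen.2 (by omega)
    have h5 := T.col_strict hik h4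
    have h6 := T.row_weak (i := i) (j1 := ((i : ℤ) + x).toNat) (j2 := ((k : ℤ) + x).toNat)
      (by omega) (YoungDiagram.mem_iff_lt_rowLen.2 (by omega))
    exact Or.inr ⟨by omega, by omega⟩

variable (T) in
/-- The number of cells counted by `FilledBy` on the diagonal of content `x`. -/
noncomputable def filledCount (x : ℤ) (y : ℕ) : ℕ := sInf {i | ¬ FilledBy T x y i}

lemma lt_filledCount_iff (x : ℤ) (y i : ℕ) : i < filledCount T x y ↔ FilledBy T x y i := by
  constructor
  · intro h
    by_contra h1
    exact absurd (Nat.sInf_le (s := {i | ¬ FilledBy T x y i}) h1) (not_le.2 h)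
  · intro h
    by_contra h1
    have hne : {i | ¬ FilledBy T x y i}.Nonempty := by
      -- At this index the column `i + x` is at least the first part, so the cell lies to the right
      -- of the diagram.
      refine ⟨(-x).toNat + mu.rowLen 0 , ?_⟩
      rintro (h2 | ⟨h2, -⟩)
      · omega
      · have := mu.rowLen_anti 0 ((-x).toNat + mu.rowLen 0) (by omega)
        omega
    exact Nat.sInf_mem hne (h.of_le (not_lt.1 h1))

/-- The height function of an Okounkov–Olshanski tableau. -/
noncomputable def OOT.toHeightFunction (T : OOT lam mu) :
    HeightFunction lam mu (lam.colLen 0) where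
  val := filledCount T.1.1
  val_zero x := by
    refine eq_of_forall_lt_iff fun i => ?_
    rw [lt_filledCount_iff]
    constructor
    · rintro (h | ⟨h1, h2⟩)
      · omega
      · by_contra h3
        have := (T.1.2 (i, ((i : ℤ) + x).toNat)
          (HeightFunction.mem_cells_iff.2 (by simp only; omega))).1
        simp only at this
        omega
    · intro h
      left
      omega
  lt_val_iff x y hy i := by
    rw [lt_filledCount_iff]
    constructor
    · rintro (h | h)
      · omega
      · exact h.1
    · intro h
      rcases lt_or_ge ((i : ℤ) + x) 0 with h0 | h0
      · exact Or.inl h0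
      · have := (T.1.2 (i, ((i : ℤ) + x).toNat)
          (HeightFunction.mem_cells_iff.2 (by simp only; omega))).2
        simp only at this
        exact Or.inr ⟨h, by omega⟩
  val_add_one_le x y := by
    refine le_of_forall_lt fun i => ?_
    rw [lt_filledCount_iff, lt_filledCount_iff]
    rcases lt_or_ge ((i : ℤ) + x) 0 with h0 | h0
    · exact fun _ => Or.inl h0
    · rintro (h | ⟨h1, h2⟩)
      · left; omega
      · have := T.1.1.row_weak (i := i) (j1 := ((i : ℤ) + x).toNat)
          (j2 := ((i : ℤ) + (x + 1)).toNat) (by omega)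
          (YoungDiagram.mem_iff_lt_rowLen.2 (by omega))
        exact Or.inr ⟨by omega, by omega⟩
  le_val_succ x y := by
    refine le_of_forall_lt fun i => ?_
    rw [lt_filledCount_iff, lt_filledCount_iff]
    exact Or.imp id fun h => ⟨h.1, by omega⟩
  val_succ_le x y := by
    by_contra hlt
    rw [not_le, lt_filledCount_iff] at hlt
    have hn := mt (lt_filledCount_iff (T := T.1.1) (x + 1) y _).2 (lt_irrefl _)
    generalize filledCount T.1.1 (x + 1) y = i at hlt hn
    apply hn
    -- With `i` the count on diagonal `x + 1`, failure of interlacing fills `(i + 1, i + 1 + x)` by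
    -- `y + 1`. By column strictness the cell above it, on diagonal `x + 1`, is filled by `y`,
    -- contradicting the choice of `i`.
    rcases hlt with h | ⟨h1, h2⟩
    · left; push_cast at h; omega
    · have h3 := mu.rowLen_anti i (i + 1) (by omega)
      push_cast at h1 h2
      rw [add_assoc, add_comm 1 x] at h1 h2
      rcases lt_or_ge ((i : ℤ) + (x + 1)) 0 with h0 | h0
      · exact Or.inl h0
      · have h5 := T.1.1.col_strict (show i < i + 1 by omega) (j := ((i : ℤ) + (x + 1)).toNat)
          (YoungDiagram.mem_iff_lt_rowLen.2 (by omega))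
        exact Or.inr ⟨by omega, by omega⟩
  val_succ_eq_zero x y hy hx := by
    by_contra h0
    rcases (lt_filledCount_iff x (y + 1) 0).1 (Nat.pos_of_ne_zero h0) with h | ⟨h1, h2⟩
    · omega
    -- A positive count fills the top cell of the diagonal, so the condition on the first row is all
    -- that is needed.
    · have h3 := T.2 (0, x.toNat) (HeightFunction.mem_cells_iff.2 (by simp only; omega))
      simp only [content, Nat.cast_zero, zero_add] at h1 h2 h3
      have h4 := lam.rowLen_anti (lam.colLen 0 - 1 - y) (lam.colLen 0 - T.1.1 0 x.toNat) (by omega)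
      omega

lemma HeightFunction.toOOT_surjective :
    Function.Surjective (HeightFunction.toOOT (lam := lam) (mu := mu)) := by
  intro T
  refine ⟨T.toHeightFunction, ?_⟩
  refine Subtype.ext (Subtype.ext (SemistandardYoungTableau.ext fun i j => ?_))
  rw [HeightFunction.toOOT_apply]
  by_cases h : j < mu.rowLen i
  · refine eq_of_forall_ge_iff fun y => ?_
    rw [HeightFunction.entry_le_iff _ h]
    refine (lt_filledCount_iff _ _ _).trans ?_
    have h1 : (i : ℤ) + (j - i) = j := by ring
    simp [FilledBy, h1, h]
  · rw [HeightFunction.entry_of_notMem _ h, T.1.1.zeros (mt YoungDiagram.mem_iff_lt_rowLen.1 h)]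

/-- Height functions are the same as Okounkov–Olshanski tableaux. -/
noncomputable def ootEquiv : HeightFunction lam mu (lam.colLen 0) ≃ OOT lam mu :=
  Equiv.ofBijective _ ⟨HeightFunction.toOOT_injective, HeightFunction.toOOT_surjective⟩

/-! ### Nonzero terms of the Okounkov–Olshanski formula -/

lemma prefactor_ne_zero : prefactor lam mu ≠ 0 := by
  refine div_ne_zero (by exact_mod_cast Nat.factorial_ne_zero _) ?_
  refine Finset.prod_ne_zero_iff.2 fun u hu => ?_
  have h1 := HeightFunction.mem_cells_iff.1 hu
  have h2 := YoungDiagram.mem_iff_lt_colLen.1 (show (u.1, u.2) ∈ lam from (YoungDiagram.mem_cells _).1 hu)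
  have : hook lam u ≠ 0 := by
    rw [hook]
    omega
  exact_mod_cast this

/-- A tableau without zero weights has positive weights, because the weights drop by at most one
at each step to the right and are nonnegative in the first column. -/
lemma isOO_of_weight_ne_zero (h : ∀ u ∈ mu.cells, cellWeight lam T u ≠ 0) : IsOO lam T := by
  suffices H : ∀ (i j : ℕ), j < mu.rowLen i → 0 < cellWeight lam T (i, j) from fun u hu => by
    have := H u.1 u.2 (HeightFunction.mem_cells_iff.1 hu)
    rw [cellWeight] at this
    exact sub_pos.1 this
  intro i j
  induction j with
  | zero =>
    intro hj
    have := h (i, 0) (HeightFunction.mem_cells_iff.2 hj)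
    simp only [cellWeight, content] at this ⊢
    omega
  | succ j ih =>
    intro hj
    have h1 := ih (by omega)
    have h2 := h (i, j + 1) (HeightFunction.mem_cells_iff.2 hj)
    have h3 := T.row_weak (show j < j + 1 by omega) (YoungDiagram.mem_iff_lt_rowLen.2 hj)
    have h4 := lam.rowLen_anti (lam.colLen 0 - T i (j + 1)) (lam.colLen 0 - T i j) (by omega)
    simp only [cellWeight, content] at h1 h2 ⊢
    push_cast at h2 ⊢
    omega

lemma ooTerm_ne_zero_iff : ooTerm lam T ≠ 0 ↔ IsOO lam T := by
  rw [ooTerm, mul_ne_zero_iff, and_iff_right prefactor_ne_zero, Finset.prod_ne_zero_iff]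
  simp only [ne_eq, Int.cast_eq_zero]
  refine ⟨isOO_of_weight_ne_zero, fun h u hu => ?_⟩
  have := h u hu
  rw [cellWeight]
  omega

end ofTableau

/-! ### Local covering conditions for lozenge tilings -/

lemma existsUnique_or_iff {α : Type*} {p : α → Prop} {a b c : α} (hab : a ≠ b) (hac : a ≠ c)
    (hbc : b ≠ c) : (∃! x, p x ∧ (x = a ∨ x = b ∨ x = c)) ↔
      (p a ∧ ¬ p b ∧ ¬ p c) ∨ (¬ p a ∧ p b ∧ ¬ p c) ∨ (¬ p a ∧ ¬ p b ∧ p c) := by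
  constructor
  · rintro ⟨x, ⟨hx, hx' | hx' | hx'⟩, hu⟩
    · subst hx'
      exact Or.inl ⟨hx, fun h => hab (hu b ⟨h, by simp⟩).symm,
        fun h => hac (hu c ⟨h, by simp⟩).symm⟩
    · subst hx'
      exact Or.inr (Or.inl ⟨fun h => hab (hu a ⟨h, by simp⟩), hx,
        fun h => hbc (hu c ⟨h, by simp⟩).symm⟩)
    · subst hx'
      exact Or.inr (Or.inr ⟨fun h => hac (hu a ⟨h, by simp⟩),
        fun h => hbc (hu b ⟨h, by simp⟩), hx⟩)
  · rintro (⟨h1, h2, h3⟩ | ⟨h1, h2, h3⟩ | ⟨h1, h2, h3⟩)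
    · refine ⟨a, ⟨h1, by simp⟩, ?_⟩
      rintro y ⟨hy, rfl | rfl | rfl⟩ <;> simp_all
    · refine ⟨b, ⟨h2, by simp⟩, ?_⟩
      rintro y ⟨hy, rfl | rfl | rfl⟩ <;> simp_all
    · refine ⟨c, ⟨h3, by simp⟩, ?_⟩
      rintro y ⟨hy, rfl | rfl | rfl⟩ <;> simp_all

lemma up_mem_cells_iff {l : Lozenge} {x y : ℤ} : Tri.up x y ∈ l.cells ↔
    l = ⟨.vertical, x, y⟩ ∨ l = ⟨.nwse, x, y⟩ ∨ l = ⟨.nesw, x, y⟩ := by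
  rcases l with ⟨o, u, v⟩
  cases o <;> simp [Lozenge.cells, rhombusCells, eq_comm]

lemma down_mem_cells_iff {l : Lozenge} {x y : ℤ} : Tri.down x y ∈ l.cells ↔
    l = ⟨.vertical, x, y + 1⟩ ∨ l = ⟨.nwse, x + 1, y⟩ ∨ l = ⟨.nesw, x, y⟩ := by
  rcases l with ⟨o, u, v⟩
  cases o <;> simp [Lozenge.cells, rhombusCells] <;> omega

namespace LozengeTiling

variable {R : Set Tri}

/-- Every lozenge contains an upward triangle, which the smaller family already covers by a lozenge
of the larger one. Surjectivity of the tiling map then needs only one inclusion. -/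
lemma eq_of_subset {t t' : LozengeTiling R} (h : t.lozenges ⊆ t'.lozenges) : t = t' := by
  have h1 : t.lozenges = t'.lozenges := by
    refine Finset.Subset.antisymm h fun l hl => ?_
    have hc : Tri.up l.x l.y ∈ l.cells := by
      rw [up_mem_cells_iff]
      rcases l with ⟨o, u, v⟩
      cases o <;> simp
    have hR := t'.subset l hl hc
    obtain ⟨k, ⟨hk, hk'⟩, -⟩ := t.cover _ hR
    rwa [(t'.cover _ hR).unique ⟨hl, hc⟩ ⟨h hk, hk'⟩]
  cases t
  cases t'
  congr

variable (t : LozengeTiling R) {x y : ℤ}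

lemma cover_up (h : Tri.up x y ∈ R) :
    (⟨.vertical, x, y⟩ ∈ t.lozenges ∧ ⟨.nwse, x, y⟩ ∉ t.lozenges ∧ ⟨.nesw, x, y⟩ ∉ t.lozenges) ∨
    (⟨.vertical, x, y⟩ ∉ t.lozenges ∧ ⟨.nwse, x, y⟩ ∈ t.lozenges ∧ ⟨.nesw, x, y⟩ ∉ t.lozenges) ∨
    (⟨.vertical, x, y⟩ ∉ t.lozenges ∧ ⟨.nwse, x, y⟩ ∉ t.lozenges ∧
      ⟨.nesw, x, y⟩ ∈ t.lozenges) := by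
  have := t.cover _ h
  simp only [up_mem_cells_iff] at this
  exact (existsUnique_or_iff (by simp) (by simp) (by simp)).1 this

lemma cover_down (h : Tri.down x y ∈ R) :
    (⟨.vertical, x, y + 1⟩ ∈ t.lozenges ∧ ⟨.nwse, x + 1, y⟩ ∉ t.lozenges ∧
      ⟨.nesw, x, y⟩ ∉ t.lozenges) ∨
    (⟨.vertical, x, y + 1⟩ ∉ t.lozenges ∧ ⟨.nwse, x + 1, y⟩ ∈ t.lozenges ∧
      ⟨.nesw, x, y⟩ ∉ t.lozenges) ∨
    (⟨.vertical, x, y + 1⟩ ∉ t.lozenges ∧ ⟨.nwse, x + 1, y⟩ ∉ t.lozenges ∧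
      ⟨.nesw, x, y⟩ ∈ t.lozenges) := by
  have := t.cover _ h
  simp only [down_mem_cells_iff] at this
  exact (existsUnique_or_iff (by simp) (by simp) (by simp)).1 this

lemma up_mem {o : Dir} (h : ⟨o, x, y⟩ ∈ t.lozenges) : Tri.up x y ∈ R :=
  t.subset _ h (by cases o <;> simp [Lozenge.cells, rhombusCells])

lemma down_mem_of_vertical (h : ⟨.vertical, x, y⟩ ∈ t.lozenges) : Tri.down x (y - 1) ∈ R :=
  t.subset _ h (by simp [Lozenge.cells, rhombusCells])

lemma down_mem_of_nwse (h : ⟨.nwse, x, y⟩ ∈ t.lozenges) : Tri.down (x - 1) y ∈ R :=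
  t.subset _ h (by simp [Lozenge.cells, rhombusCells])

lemma down_mem_of_nesw (h : ⟨.nesw, x, y⟩ ∈ t.lozenges) : Tri.down x y ∈ R :=
  t.subset _ h (by simp [Lozenge.cells, rhombusCells])

end LozengeTiling

/-! ### The region `∇` -/

section nabla

variable {lam mu : YoungDiagram}

lemma up_mem_nabla {x y : ℤ} : Tri.up x y ∈ nabla lam mu ↔
    (0 ≤ y ∧ y < (lam.colLen 0 : ℤ) ∧ -y ≤ x ∧ x < rightEnd lam y) ∨
      (y = (lam.colLen 0 : ℤ) ∧
        ∃ i : ℕ, i < lam.colLen 0 ∧ x = (mu.rowLen i : ℤ) - ((i : ℤ) + 1)) := Iff.rfl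

lemma down_mem_nabla {x y : ℤ} : Tri.down x y ∈ nabla lam mu ↔
    0 ≤ y ∧ y < (lam.colLen 0 : ℤ) ∧ -y - 1 ≤ x ∧ x < rightEnd lam y := Iff.rfl

lemma rightEnd_natCast (y : ℕ) : rightEnd lam y = lam.rowLen (lam.colLen 0 - 1 - y) := rfl

lemma rightEnd_nonneg (y : ℤ) : 0 ≤ rightEnd lam y := Int.natCast_nonneg _

lemma rightEnd_le_succ (y : ℕ) : rightEnd lam y ≤ rightEnd lam (y + 1 : ℕ) := by
  have := lam.rowLen_anti (lam.colLen 0 - 1 - (y + 1)) (lam.colLen 0 - 1 - y) (by omega)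
  rw [rightEnd_natCast, rightEnd_natCast]
  omega

lemma rowLen_eq_zero_of_le (hmu : mu ≤ lam) {i : ℕ} (hi : lam.colLen 0 ≤ i) :
    mu.rowLen i = 0 := by
  by_contra h
  have h1 : (i, 0) ∈ mu := YoungDiagram.mem_iff_lt_rowLen.2 (by omega)
  have h2 := YoungDiagram.mem_iff_lt_colLen.1 (hmu h1)
  omega

/-- The rows of `mu` beyond the length of `lam` are empty and give the beads left of the region; the
remaining beads are the peaks of the top boundary. -/
lemma isBead_iff (hmu : mu ≤ lam) {x : ℤ} : IsBead mu x ↔ x < -(lam.colLen 0 : ℤ) ∨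
    ∃ i : ℕ, i < lam.colLen 0 ∧ x = (mu.rowLen i : ℤ) - ((i : ℤ) + 1) := by
  constructor
  · rintro ⟨i, hi⟩
    rcases Nat.lt_or_ge i (lam.colLen 0) with h | h
    · exact Or.inr ⟨i, h, by omega⟩
    · left
      rw [rowLen_eq_zero_of_le hmu h] at hi
      omega
  · rintro (h | ⟨i, -, hi⟩)
    · refine ⟨(-x - 1).toNat, ?_⟩
      rw [rowLen_eq_zero_of_le hmu (by omega)]
      omega
    · exact ⟨i, by omega⟩

lemma up_bounds_of_mem_nabla {x y : ℤ} (h : Tri.up x y ∈ nabla lam mu) :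
    (0 ≤ y ∧ y ≤ lam.colLen 0) ∧ (-(lam.colLen 0 : ℤ) ≤ x ∧ x ≤ lam.rowLen 0 + mu.rowLen 0) := by
  rcases up_mem_nabla.1 h with ⟨h1, h2, h3, h4⟩ | ⟨rfl, i, h1, rfl⟩
  · have := lam.rowLen_anti 0 (rowFromTop lam y) (Nat.zero_le _)
    rw [rightEnd] at h4
    omega
  · have := mu.rowLen_anti 0 i (Nat.zero_le _)
    omega

end nabla

/-! ### Height functions and lozenge tilings -/

namespace HeightFunction

variable {lam mu : YoungDiagram} (H : HeightFunction lam mu (lam.colLen 0))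

/-- The lozenges of the tiling of a height function. -/
def IsLozenge (l : Lozenge) : Prop :=
  0 ≤ l.y ∧ -l.y ≤ l.x ∧ match l.dir with
    | .vertical => l.y ≤ lam.colLen 0 ∧ H.val l.x l.y.toNat = H.val (l.x + 1) l.y.toNat + 1
    | .nwse => l.y < lam.colLen 0 ∧ H.val l.x (l.y.toNat + 1) = H.val l.x l.y.toNat + 1
    | .nesw => l.y < lam.colLen 0 ∧ l.x < rightEnd lam l.y ∧
        H.val l.x (l.y.toNat + 1) = H.val (l.x + 1) l.y.toNat

lemma isLozenge_vertical (x : ℤ) (y : ℕ) : H.IsLozenge ⟨.vertical, x, y⟩ ↔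
    -(y : ℤ) ≤ x ∧ y ≤ lam.colLen 0 ∧ H.val x y = H.val (x + 1) y + 1 := by
  simp [IsLozenge]

lemma isLozenge_vertical_succ (x : ℤ) (y : ℕ) : H.IsLozenge ⟨.vertical, x, y + 1⟩ ↔
    -(y : ℤ) - 1 ≤ x ∧ y + 1 ≤ lam.colLen 0 ∧ H.val x (y + 1) = H.val (x + 1) (y + 1) + 1 := by
  have := H.isLozenge_vertical x (y + 1)
  rw [Nat.cast_succ] at this
  rw [this, neg_add']

lemma isLozenge_nwse (x : ℤ) (y : ℕ) : H.IsLozenge ⟨.nwse, x, y⟩ ↔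
    y < lam.colLen 0 ∧ H.val x (y + 1) = H.val x y + 1 := by
  simp only [IsLozenge, Int.natCast_nonneg, true_and, Int.toNat_natCast, Nat.cast_lt]
  exact ⟨fun h => h.2, fun h => ⟨(H.step_bounds h.1 h.2).1, h⟩⟩

lemma isLozenge_nesw (x : ℤ) (y : ℕ) : H.IsLozenge ⟨.nesw, x, y⟩ ↔
    -(y : ℤ) ≤ x ∧ y < lam.colLen 0 ∧ x < rightEnd lam y ∧ H.val x (y + 1) = H.val (x + 1) y := by
  simp [IsLozenge]

lemma cells_subset_nabla (hmu : mu ≤ lam) {l : Lozenge} (hl : H.IsLozenge l) :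
    l.cells ⊆ nabla lam mu := by
  rcases l with ⟨o, x, y⟩
  lift y to ℕ using hl.1
  cases o
  · rw [isLozenge_vertical] at hl
    obtain ⟨h1, h2, h3⟩ := hl
    rintro s (rfl | rfl)
    · change Tri.up x y ∈ nabla lam mu
      rw [up_mem_nabla]
      -- In the top row a bead is a bead of `mu`, so the upper half of the lozenge fills a peak;
      -- below, vanishing of heights keeps it left of the boundary.
      rcases Nat.eq_or_lt_of_le h2 with h | h
      · right
        refine ⟨by omega, ((isBead_iff hmu).1 (H.isBead_of_val h.ge h3)).resolve_left (by omega)⟩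
      · left
        refine ⟨by omega, by omega, h1, ?_⟩
        by_contra h4
        have := H.val_eq_zero (x := x) h (by rw [rightEnd_natCast] at h4; omega)
        omega
    · change Tri.down x (y - 1) ∈ nabla lam mu
      rw [down_mem_nabla]
      cases y with
      | zero =>
        rw [H.val_zero, H.val_zero] at h3
        push_cast at h1
        omega
      | succ y =>
        rw [show ((y + 1 : ℕ) : ℤ) - 1 = y by push_cast; ring]
        push_cast at h1
        refine ⟨by omega, by omega, by omega, ?_⟩
        by_contra h4
        have := H.val_succ_eq_zero x y (by omega) (by rw [rightEnd_natCast] at h4; omega)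
        omega
  · rw [isLozenge_nwse] at hl
    obtain ⟨h1, h2⟩ := hl
    have h3 := H.step_bounds h1 h2
    rw [← rightEnd_natCast] at h3
    rintro s (rfl | rfl)
    · change Tri.up x y ∈ nabla lam mu
      rw [up_mem_nabla]
      left
      omega
    · change Tri.down (x - 1) y ∈ nabla lam mu
      rw [down_mem_nabla]
      omega
  · rw [isLozenge_nesw] at hl
    rintro s (rfl | rfl)
    · change Tri.up x y ∈ nabla lam mu
      rw [up_mem_nabla]
      left
      omega
    · change Tri.down x y ∈ nabla lam mu
      rw [down_mem_nabla]
      omega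

/-- The four heights around a triangle form a chain with three gaps of total 1, and each gap belongs
to one of the three lozenges through the triangle. -/
lemma existsUnique_isLozenge (hmu : mu ≤ lam) {s : Tri} (hs : s ∈ nabla lam mu) :
    ∃! l, H.IsLozenge l ∧ s ∈ l.cells := by
  rcases s with ⟨x, y⟩ | ⟨x, y⟩
  · simp only [up_mem_cells_iff]
    rw [existsUnique_or_iff (by simp) (by simp) (by simp)]
    have hy := (up_bounds_of_mem_nabla hs).1.1
    lift y to ℕ using hy
    rw [isLozenge_vertical, isLozenge_nwse, isLozenge_nesw]
    have h1 := H.val_add_one_le x y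
    have h2 := H.le_val_succ x y
    have h3 := H.val_succ_le x y
    rcases up_mem_nabla.1 hs with h | ⟨h, hi⟩
    · omega
    · have h4 := H.val_of_isBead (y := y) (by omega) ((isBead_iff hmu).2 (Or.inr hi))
      obtain ⟨i, hi1, hi2⟩ := hi
      omega
  · simp only [down_mem_cells_iff]
    rw [existsUnique_or_iff (by simp) (by simp) (by simp)]
    rw [down_mem_nabla] at hs
    have hy := hs.1
    lift y to ℕ using hy
    rw [isLozenge_vertical_succ, isLozenge_nwse, isLozenge_nesw]
    have h1 := H.val_add_one_le x (y + 1)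
    have h2 := H.le_val_succ (x + 1) y
    have h3 := H.val_succ_le x y
    -- At the left boundary a NE-SW rhombus would leave the region; the frozen heights rule it out.
    rcases eq_or_lt_of_le hs.2.2.1 with h | h
    · have h4 := H.val_of_le_neg x (y + 1) (by push_cast; omega)
      have h5 := H.val_of_le_neg (x + 1) y (by omega)
      omega
    · omega

lemma finite_isLozenge (hmu : mu ≤ lam) : {l | H.IsLozenge l}.Finite := by
  refine Set.Finite.subset (((Set.toFinite {Dir.vertical, Dir.nwse, Dir.nesw}).prod
    ((Set.finite_Icc (-(lam.colLen 0 : ℤ)) (lam.rowLen 0 + mu.rowLen 0)).prod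
      (Set.finite_Icc (0 : ℤ) (lam.colLen 0)))).image fun p => ⟨p.1, p.2.1, p.2.2⟩) ?_
  intro l hl
  have h := up_bounds_of_mem_nabla (H.cells_subset_nabla hmu hl
    (show Tri.up l.x l.y ∈ l.cells by
      rw [up_mem_cells_iff]
      rcases l with ⟨o, u, v⟩
      cases o <;> simp))
  refine ⟨(l.dir, l.x, l.y), ⟨?_, h.2, h.1⟩, rfl⟩
  rcases l with ⟨o, u, v⟩
  cases o <;> simp

/-- The lozenge tiling of a height function. -/
noncomputable def toTiling (hmu : mu ≤ lam) : LozengeTiling (nabla lam mu) where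
  lozenges := (H.finite_isLozenge hmu).toFinset
  subset l hl := H.cells_subset_nabla hmu (by simpa using hl)
  cover s hs := by simpa using H.existsUnique_isLozenge hmu hs

lemma mem_toTiling {hmu : mu ≤ lam} {l : Lozenge} :
    l ∈ (H.toTiling hmu).lozenges ↔ H.IsLozenge l := by
  simp [toTiling]

lemma toTiling_injective (hmu : mu ≤ lam) :
    Function.Injective fun H : HeightFunction lam mu (lam.colLen 0) => H.toTiling hmu := by
  intro H K h
  refine ext_of_step fun x y hy => ?_
  have h1 : H.IsLozenge ⟨.nwse, x, y⟩ ↔ K.IsLozenge ⟨.nwse, x, y⟩ := by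
    rw [← mem_toTiling (hmu := hmu), ← mem_toTiling (hmu := hmu)]
    simp only at h
    rw [h]
  simpa [isLozenge_nwse, hy] using h1

-- Beads are read from vertical lozenges and increments from NW-SE rhombi. The positions left of
-- `-y`, outside the region, are declared to be beads so that the row relations hold on all of `ℤ`.
open Classical in
lemma toTiling_surjective (hmu : mu ≤ lam) :
    Function.Surjective fun H : HeightFunction lam mu (lam.colLen 0) => H.toTiling hmu := by
  intro t
  set d := lam.colLen 0 with hd
  have anti : ∀ y : ℕ, ∀ x, ⟨.vertical, x, ((y + 1 : ℕ) : ℤ)⟩ ∈ t.lozenges →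
      x < rightEnd lam y ∧ -(y : ℤ) - 1 ≤ x := by
    intro y x h
    have := down_mem_nabla.1 (t.down_mem_of_vertical h)
    rw [show ((y + 1 : ℕ) : ℤ) - 1 = y by push_cast; ring] at this
    omega
  have vert_zero : ∀ x, ⟨.vertical, x, ((0 : ℕ) : ℤ)⟩ ∉ t.lozenges := fun x h => by
    exact absurd (down_mem_nabla.1 (t.down_mem_of_vertical h)).1 (by norm_num)
  have vert_top : ∀ x, ⟨.vertical, x, (d : ℤ)⟩ ∈ t.lozenges ↔
      ∃ i : ℕ, i < lam.colLen 0 ∧ x = (mu.rowLen i : ℤ) - ((i : ℤ) + 1) := by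
    intro x
    constructor
    · intro h
      have := up_mem_nabla.1 (t.up_mem h)
      rcases this with h1 | h1
      · omega
      · exact h1.2
    · intro h
      rcases t.cover_up (up_mem_nabla.2 (Or.inr ⟨rfl, h⟩)) with h1 | h1 | h1
      · exact h1.1
      · have := down_mem_nabla.1 (t.down_mem_of_nwse h1.2.1)
        omega
      · have := down_mem_nabla.1 (t.down_mem_of_nesw h1.2.2)
        omega
  have bead : ∀ x, IsBead mu x ↔ x < -(d : ℤ) ∨ ⟨.vertical, x, (d : ℤ)⟩ ∈ t.lozenges :=
    fun x => by rw [vert_top, isBead_iff hmu]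
  have nw_bounds : ∀ (y : ℕ) x, y < d → ⟨.nwse, x, (y : ℤ)⟩ ∈ t.lozenges →
      -(y : ℤ) ≤ x ∧ x < rightEnd lam y := fun y x hy h => by
    rcases up_mem_nabla.1 (t.up_mem h) with h1 | h1 <;> omega
  have ne_bounds : ∀ (y : ℕ) x, y < d → ⟨.nesw, x, (y : ℤ)⟩ ∈ t.lozenges →
      -(y : ℤ) ≤ x ∧ x < rightEnd lam y := fun y x hy h => by
    rcases up_mem_nabla.1 (t.up_mem h) with h1 | h1 <;> omega
  obtain ⟨H, Hz, He⟩ := HeightFunction.exists_of_rows (lam := lam) (mu := mu) (d := d)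
    (z := fun x y => if x < -(y : ℤ) ∨ ⟨.vertical, x, (y : ℤ)⟩ ∈ t.lozenges then 1 else 0)
    (e := fun x y => if ⟨.nwse, x, (y : ℤ)⟩ ∈ t.lozenges then 1 else 0)
    (fun x => by simp only [vert_zero, or_false]; simp)
    (fun x hx => by simp only [← bead, hx, if_true])
    (fun x hx => by simp only [← bead, hx, if_false])
    -- Where both triangles at `(x, y)` lie in the region, each side is 1 minus the indicator of the
    -- NE-SW rhombus there: the left side by covering the downward triangle, the right side by
    -- covering the upward one. The boundary cases follow from the bounds collected above.
    (fun x y hy => by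
      have hR := rightEnd_nonneg (lam := lam) y
      have h1 := anti y x
      have h2 := nw_bounds y x hy
      have h3 := nw_bounds y (x + 1) hy
      have h4 := ne_bounds y x hy
      have h5 : ⟨.vertical, x, (y : ℤ)⟩ ∈ t.lozenges → x < rightEnd lam y ∧ -(y : ℤ) ≤ x := by
        intro h
        cases y with
        | zero => exact absurd h (vert_zero x)
        | succ y =>
          have := anti y x h
          have := rightEnd_le_succ (lam := lam) y
          push_cast at *
          omega
      have h6 := t.cover_down (x := x) (y := y)
      rw [down_mem_nabla] at h6
      have h7 := t.cover_up (x := x) (y := y)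
      rw [up_mem_nabla] at h7
      simp only [Nat.cast_succ] at h1 ⊢
      by_cases hV : (⟨.vertical, x, (y : ℤ)⟩ : Lozenge) ∈ t.lozenges <;>
      by_cases hV' : (⟨.vertical, x, (y : ℤ) + 1⟩ : Lozenge) ∈ t.lozenges <;>
      by_cases hN : (⟨.nwse, x, (y : ℤ)⟩ : Lozenge) ∈ t.lozenges <;>
      by_cases hN' : (⟨.nwse, x + 1, (y : ℤ)⟩ : Lozenge) ∈ t.lozenges <;>
      by_cases hE : (⟨.nesw, x, (y : ℤ)⟩ : Lozenge) ∈ t.lozenges <;>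
      simp only [hV, hV', hN, hN', hE, not_true_eq_false, not_false_eq_true, and_true, and_false,
        or_false, or_true, if_true, if_false, true_implies, false_implies, implies_true, imp_false,
        not_and] at * <;>
      (try split_ifs) <;> omega)
    (fun x y hy => by
      have h6 := t.cover_down (x := x) (y := y)
      have h3 := nw_bounds y (x + 1) hy
      rw [down_mem_nabla] at h6
      simp only [Nat.cast_succ]
      by_cases hV' : (⟨.vertical, x, (y : ℤ) + 1⟩ : Lozenge) ∈ t.lozenges <;>
      by_cases hN' : (⟨.nwse, x + 1, (y : ℤ)⟩ : Lozenge) ∈ t.lozenges <;>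
      simp only [hV', hN', not_true_eq_false, not_false_eq_true, true_and, false_and, and_false,
        or_false, false_or, or_true, if_true, if_false, true_implies, false_implies, imp_false,
        not_and] at * <;>
      (try split_ifs) <;> omega)
    (fun x y hy hx => by
      have h3 := nw_bounds y x hy
      change rightEnd lam y ≤ x at hx
      rw [if_neg]
      intro h
      have := h3 h
      omega)
  refine ⟨H, (LozengeTiling.eq_of_subset fun l hl => ?_).symm⟩
  rw [mem_toTiling]
  have h1 := t.up_mem hl
  rcases l with ⟨o, x, y⟩
  have h2 := up_bounds_of_mem_nabla h1
  simp only at h1 h2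
  have hy := h2.1.1
  lift y to ℕ using hy
  have hx : -(y : ℤ) ≤ x := by
    rcases up_mem_nabla.1 h1 with h | ⟨h, i, hi, hx⟩ <;> omega
  cases o
  · rw [isLozenge_vertical]
    refine ⟨hx, by omega, ?_⟩
    rw [Hz x y (by omega), if_pos (Or.inr hl)]
  · have h3 := down_mem_nabla.1 (t.down_mem_of_nwse hl)
    rw [isLozenge_nwse]
    refine ⟨by omega, ?_⟩
    rw [He x y (by omega), if_pos hl]
  · have h3 := down_mem_nabla.1 (t.down_mem_of_nesw hl)
    rw [isLozenge_nesw]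
    refine ⟨hx, by omega, h3.2.2.2, ?_⟩
    have h4 := t.cover_up h1
    have h5 : ⟨.vertical, x, (y : ℤ)⟩ ∉ t.lozenges := by tauto
    have h6 : ⟨.nwse, x, (y : ℤ)⟩ ∉ t.lozenges := by tauto
    rw [He x y (by omega), if_neg h6, Hz x y (by omega),
      if_neg (not_or.2 ⟨by omega, h5⟩), add_zero, add_zero]

end HeightFunction

/-- Height functions are the same as lozenge tilings of `∇`. -/
noncomputable def tilingEquiv {lam mu : YoungDiagram} (hmu : mu ≤ lam) :
    HeightFunction lam mu (lam.colLen 0) ≃ LozengeTiling (nabla lam mu) :=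
  Equiv.ofBijective _
    ⟨HeightFunction.toTiling_injective hmu, HeightFunction.toTiling_surjective hmu⟩

lemma mem_tilingEquiv {lam mu : YoungDiagram} {hmu : mu ≤ lam}
    {H : HeightFunction lam mu (lam.colLen 0)} {l : Lozenge} :
    l ∈ (tilingEquiv hmu H).lozenges ↔ H.IsLozenge l := H.mem_toTiling (hmu := hmu)

/-! ### Positions and counts of the zeros of a word -/

section word

variable {a : ℕ} {m : YoungDiagram}

lemma word_eq_zero_iff {k : ℕ} : word a m k = 0 ↔ ∃ i < a, k = zeroPos a m i := by
  rw [word]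
  split_ifs with h
  · simpa using h
  · simpa using h

lemma word_eq_one_iff {k : ℕ} : word a m k = 1 ↔ ¬ word a m k = 0 := by
  generalize word a m k = l
  fin_cases l <;> simp

/-- The position of the zero of the word of `m` that comes from row `y`, counted from the
bottom. -/
def zeroAt (a : ℕ) (m : YoungDiagram) (y : ℕ) : ℕ := m.rowLen (a - 1 - y) + y

lemma zeroAt_lt {y y' : ℕ} (h : y < y') : zeroAt a m y < zeroAt a m y' := by
  have := m.rowLen_anti (a - 1 - y') (a - 1 - y) (by omega)
  rw [zeroAt, zeroAt]
  omega

lemma word_eq_zero_iff_zeroAt {k : ℕ} : word a m k = 0 ↔ ∃ y < a, k = zeroAt a m y := by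
  rw [word_eq_zero_iff]
  constructor
  · rintro ⟨i, hi, rfl⟩
    refine ⟨a - 1 - i, by omega, ?_⟩
    rw [zeroPos, zeroAt, show a - 1 - (a - 1 - i) = i by omega]
  · rintro ⟨y, hy, rfl⟩
    refine ⟨a - 1 - y, by omega, ?_⟩
    rw [zeroPos, zeroAt, show a - 1 - (a - 1 - y) = y by omega]

/-- The number of zeros among the first `k` letters of the word of `m`. -/
def zeroCount (a : ℕ) (m : YoungDiagram) (k : ℕ) : ℕ := Nat.count (fun j => word a m j = 0) k

lemma zeroCount_zero : zeroCount a m 0 = 0 := Nat.count_zero _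

lemma zeroCount_succ_of_zero {k : ℕ} (h : word a m k = 0) :
    zeroCount a m (k + 1) = zeroCount a m k + 1 := by
  rw [zeroCount, Nat.count_succ, if_pos h, zeroCount]

lemma zeroCount_succ_of_one {k : ℕ} (h : word a m k = 1) :
    zeroCount a m (k + 1) = zeroCount a m k := by
  rw [zeroCount, Nat.count_succ, if_neg (word_eq_one_iff.1 h), zeroCount, add_zero]

/-- The zeros sit at the strictly increasing positions `zeroAt a m y`, so a count of `c` places `k`
after zero `c - 1` and no later than zero `c`. At a zero this identifies the row belonging to strip
`k`. -/
lemma zeroCount_spec (k : ℕ) : zeroCount a m k ≤ a ∧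
    (∀ y, y + 1 = zeroCount a m k → zeroAt a m y < k) ∧
    (zeroCount a m k < a → k ≤ zeroAt a m (zeroCount a m k)) ∧
    (word a m k = 0 → zeroCount a m k < a ∧ k = zeroAt a m (zeroCount a m k)) := by
  -- The last conjunct follows from the other three by strict monotonicity, and the induction step
  -- for those three uses it.
  have key : ∀ k, zeroCount a m k ≤ a → (∀ y, y + 1 = zeroCount a m k → zeroAt a m y < k) →
      (zeroCount a m k < a → k ≤ zeroAt a m (zeroCount a m k)) →
      (word a m k = 0 → zeroCount a m k < a ∧ k = zeroAt a m (zeroCount a m k)) := by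
    intro k h1 h2 h3 h
    obtain ⟨y, hy, hk⟩ := word_eq_zero_iff_zeroAt.1 h
    rcases lt_trichotomy y (zeroCount a m k) with h4 | h4 | h4
    · obtain ⟨c, hc⟩ : ∃ c, c + 1 = zeroCount a m k := ⟨zeroCount a m k - 1, by omega⟩
      have h5 := h2 c hc
      rcases Nat.eq_or_lt_of_le (show y ≤ c by omega) with rfl | h6
      · omega
      · have := zeroAt_lt (a := a) (m := m) h6
        omega
    · subst h4
      exact ⟨hy, hk⟩
    · have := h3 (by omega)
      have := zeroAt_lt (a := a) (m := m) h4
      omega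
  suffices h : zeroCount a m k ≤ a ∧ (∀ y, y + 1 = zeroCount a m k → zeroAt a m y < k) ∧
      (zeroCount a m k < a → k ≤ zeroAt a m (zeroCount a m k)) from
    ⟨h.1, h.2.1, h.2.2, key k h.1 h.2.1 h.2.2⟩
  induction k with
  | zero => simp [zeroCount_zero]
  | succ k ih =>
    obtain ⟨h1, h2, h3⟩ := ih
    by_cases h : word a m k = 0
    · obtain ⟨h4, h5⟩ := key k h1 h2 h3 h
      rw [zeroCount_succ_of_zero h]
      refine ⟨h4, fun y hy => ?_, fun _ => ?_⟩
      · obtain rfl : y = zeroCount a m k := by omega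
        omega
      · have := zeroAt_lt (a := a) (m := m) (Nat.lt_succ_self (zeroCount a m k))
        rw [Nat.succ_eq_add_one] at this
        omega
    · rw [zeroCount_succ_of_one (word_eq_one_iff.2 h)]
      refine ⟨h1, fun y hy => (h2 y hy).trans (Nat.lt_succ_self k), fun h4 => ?_⟩
      have h5 := h3 h4
      have h6 : k ≠ zeroAt a m (zeroCount a m k) := fun h7 =>
        h (word_eq_zero_iff_zeroAt.2 ⟨_, h4, h7⟩)
      omega

lemma word_zeroAt {y : ℕ} (hy : y < a) : word a m (zeroAt a m y) = 0 :=
  word_eq_zero_iff_zeroAt.2 ⟨y, hy, rfl⟩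

lemma zeroCount_zeroAt {y : ℕ} (hy : y < a) : zeroCount a m (zeroAt a m y) = y := by
  have h := ((zeroCount_spec _).2.2.2 (word_zeroAt (m := m) hy)).2
  rcases lt_trichotomy y (zeroCount a m (zeroAt a m y)) with h1 | h1 | h1
  · exact absurd h (zeroAt_lt h1).ne
  · exact h1.symm
  · exact absurd h (zeroAt_lt h1).ne'

lemma zeroAt_lt_add {b y : ℕ} (hb : m.rowLen 0 ≤ b) (hy : y < a) : zeroAt a m y < a + b := by
  have := m.rowLen_anti 0 (a - 1 - y) (Nat.zero_le _)
  rw [zeroAt]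
  omega

lemma zeroCount_add {b : ℕ} (hb : m.rowLen 0 ≤ b) : zeroCount a m (a + b) = a := by
  obtain ⟨h1, -, h3, -⟩ := zeroCount_spec (a := a) (m := m) (a + b)
  by_contra h
  have h4 : zeroCount a m (a + b) < a := by omega
  have := h3 h4
  have := zeroAt_lt_add hb h4
  omega

end word

/-! ### Puzzle pieces and propagation of labels -/

lemma up_mem_bigTriangle {n : ℕ} {x y : ℤ} :
    Tri.up x y ∈ bigTriangle n ↔ 0 ≤ x ∧ 0 ≤ y ∧ x + y + 1 ≤ (n : ℤ) := Iff.rfl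

lemma down_mem_bigTriangle {n : ℕ} {x y : ℤ} :
    Tri.down x y ∈ bigTriangle n ↔ 0 ≤ x ∧ 0 ≤ y ∧ x + y + 2 ≤ (n : ℤ) := Iff.rfl

lemma up_mem_piece_iff {p : PuzzlePiece} {x y : ℤ} : Tri.up x y ∈ p.cells ↔
    p = ⟨.upTri 0, x, y⟩ ∨ p = ⟨.upTri 1, x, y⟩ ∨ p = ⟨.rhombus .vertical, x, y⟩ ∨
    p = ⟨.equivariant, x, y⟩ ∨ p = ⟨.rhombus .nwse, x, y⟩ ∨ p = ⟨.rhombus .nesw, x, y⟩ := by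
  rcases p with ⟨κ, u, v⟩
  rcases κ with l | l | o | _
  · fin_cases l <;> simp [PuzzlePiece.cells, eq_comm]
  · simp [PuzzlePiece.cells]
  · cases o <;> simp [PuzzlePiece.cells, rhombusCells, eq_comm]
  · simp [PuzzlePiece.cells, rhombusCells, eq_comm]

lemma down_mem_piece_iff {p : PuzzlePiece} {x y : ℤ} : Tri.down x y ∈ p.cells ↔
    p = ⟨.downTri 0, x, y⟩ ∨ p = ⟨.downTri 1, x, y⟩ ∨ p = ⟨.rhombus .vertical, x, y + 1⟩ ∨
    p = ⟨.equivariant, x, y + 1⟩ ∨ p = ⟨.rhombus .nwse, x + 1, y⟩ ∨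
    p = ⟨.rhombus .nesw, x, y⟩ := by
  rcases p with ⟨κ, u, v⟩
  rcases κ with l | l | o | _
  · simp [PuzzlePiece.cells]
  · fin_cases l <;> simp [PuzzlePiece.cells, eq_comm]
  · cases o <;> simp [PuzzlePiece.cells, rhombusCells] <;> omega
  · simp [PuzzlePiece.cells, rhombusCells]
    omega

lemma cells_of_slash_mem {p : PuzzlePiece} {x y : ℤ} {l : Fin 2} (h : (.slash x y, l) ∈ p.sides) :
    Tri.up x y ∈ p.cells ∨ Tri.down (x - 1) y ∈ p.cells := by
  rcases p with ⟨κ, u, v⟩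
  rcases κ with l | l | o | _
  · simp [PuzzlePiece.sides] at h
    simp [PuzzlePiece.cells, h]
  · simp [PuzzlePiece.sides] at h
    simp [PuzzlePiece.cells, h]
  · cases o <;> simp [PuzzlePiece.sides] at h <;>
      simp [PuzzlePiece.cells, rhombusCells] <;> omega
  · simp [PuzzlePiece.sides] at h
    simp [PuzzlePiece.cells, rhombusCells]
    omega

lemma cells_of_back_mem {p : PuzzlePiece} {x y : ℤ} {l : Fin 2} (h : (.back x y, l) ∈ p.sides) :
    Tri.up x y ∈ p.cells ∨ Tri.down x y ∈ p.cells := by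
  rcases p with ⟨κ, u, v⟩
  rcases κ with l | l | o | _
  · simp [PuzzlePiece.sides] at h
    simp [PuzzlePiece.cells, h]
  · simp [PuzzlePiece.sides] at h
    simp [PuzzlePiece.cells, h]
  · cases o <;> simp [PuzzlePiece.sides] at h <;>
      simp [PuzzlePiece.cells, rhombusCells] <;> omega
  · simp [PuzzlePiece.sides] at h
    simp [PuzzlePiece.cells, rhombusCells]
    omega

namespace Puzzle

section basic

variable {a b : ℕ} {m₁ m₂ m₃ : YoungDiagram} (P : Puzzle a b m₁ m₂ m₃) {x y : ℤ}

variable {P} in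
lemma unique {p q : PuzzlePiece} (hp : p ∈ P.pieces) (hq : q ∈ P.pieces) {s : Tri}
    (h : s ∈ p.cells) (h' : s ∈ q.cells) : p = q :=
  (P.cover s (P.subset p hp h)).unique ⟨hp, h⟩ ⟨hq, h'⟩

lemma eq_of_subset {P Q : Puzzle a b m₁ m₂ m₃} (h : P.pieces ⊆ Q.pieces) : P = Q := by
  have h1 : P.pieces = Q.pieces := by
    refine Finset.Subset.antisymm h fun q hq => ?_
    obtain ⟨s, hs⟩ : ∃ s, s ∈ q.cells := by
      rcases q with ⟨l | l | o | _, u, v⟩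
      · exact ⟨.up u v, rfl⟩
      · exact ⟨.down u v, rfl⟩
      · cases o <;> exact ⟨.up u v, Or.inl rfl⟩
      · exact ⟨.up u v, Or.inl rfl⟩
    obtain ⟨p, ⟨hp, hp'⟩, -⟩ := P.cover s (Q.subset q hq hs)
    rwa [unique hq (h hp) hs hp']
  cases P
  cases Q
  congr

lemma exists_up (h : Tri.up x y ∈ bigTriangle (a + b)) :
    ⟨.upTri 0, x, y⟩ ∈ P.pieces ∨ ⟨.upTri 1, x, y⟩ ∈ P.pieces ∨
    ⟨.rhombus .vertical, x, y⟩ ∈ P.pieces ∨ ⟨.equivariant, x, y⟩ ∈ P.pieces ∨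
    ⟨.rhombus .nwse, x, y⟩ ∈ P.pieces ∨ ⟨.rhombus .nesw, x, y⟩ ∈ P.pieces := by
  obtain ⟨p, ⟨hp, hs⟩, -⟩ := P.cover _ h
  rcases up_mem_piece_iff.1 hs with rfl | rfl | rfl | rfl | rfl | rfl <;> simp [hp]

lemma exists_down (h : Tri.down x y ∈ bigTriangle (a + b)) :
    ⟨.downTri 0, x, y⟩ ∈ P.pieces ∨ ⟨.downTri 1, x, y⟩ ∈ P.pieces ∨
    ⟨.rhombus .vertical, x, y + 1⟩ ∈ P.pieces ∨ ⟨.equivariant, x, y + 1⟩ ∈ P.pieces ∨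
    ⟨.rhombus .nwse, x + 1, y⟩ ∈ P.pieces ∨ ⟨.rhombus .nesw, x, y⟩ ∈ P.pieces := by
  obtain ⟨p, ⟨hp, hs⟩, -⟩ := P.cover _ h
  rcases down_mem_piece_iff.1 hs with rfl | rfl | rfl | rfl | rfl | rfl <;> simp [hp]

variable {P}

lemma up_unique {κ κ' : PieceKind} (h : ⟨κ, x, y⟩ ∈ P.pieces) (h' : ⟨κ', x, y⟩ ∈ P.pieces)
    (hκ : Tri.up x y ∈ (⟨κ, x, y⟩ : PuzzlePiece).cells)
    (hκ' : Tri.up x y ∈ (⟨κ', x, y⟩ : PuzzlePiece).cells) : κ = κ' := by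
  have := unique h h' hκ hκ'
  injection this

lemma up_of_mem {κ : PieceKind} (h : ⟨κ, x, y⟩ ∈ P.pieces)
    (hκ : Tri.up x y ∈ (⟨κ, x, y⟩ : PuzzlePiece).cells) : 0 ≤ x ∧ 0 ≤ y ∧ x + y + 1 ≤ a + b := by
  have := up_mem_bigTriangle.1 (P.subset _ h hκ)
  push_cast at this
  exact this

lemma down_of_mem {κ : PieceKind} {u v : ℤ} (h : ⟨κ, u, v⟩ ∈ P.pieces)
    (hκ : Tri.down x y ∈ (⟨κ, u, v⟩ : PuzzlePiece).cells) :
    0 ≤ x ∧ 0 ≤ y ∧ x + y + 2 ≤ a + b := by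
  have := down_mem_bigTriangle.1 (P.subset _ h hκ)
  push_cast at this
  exact this

/-- That edge is the short diagonal of the rhombus, hence interior to it, and both triangles at the
edge are already taken. -/
lemma notMem_nwse_of_slash {q : PuzzlePiece} {l : Fin 2} (hq : q ∈ P.pieces)
    (h : (.slash x y, l) ∈ q.sides) : ⟨.rhombus .nwse, x, y⟩ ∉ P.pieces := by
  intro h1
  have h2 : q = ⟨.rhombus .nwse, x, y⟩ := by
    rcases cells_of_slash_mem h with h3 | h3
    · exact unique hq h1 h3 (Or.inl rfl)
    · exact unique hq h1 h3 (Or.inr rfl)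
  subst h2
  simp [PuzzlePiece.sides] at h

/-- The upward triangle at `(x, y)` has label `1` on its left side. -/
def IsOne (P : Puzzle a b m₁ m₂ m₃) (x y : ℤ) : Prop :=
  ⟨.upTri 1, x, y⟩ ∈ P.pieces ∨ ⟨.rhombus .vertical, x, y⟩ ∈ P.pieces

lemma isOne_of_slash {q : PuzzlePiece} (hR : Tri.up x y ∈ bigTriangle (a + b))
    (hq : q ∈ P.pieces) (h : (.slash x y, 1) ∈ q.sides) : P.IsOne x y := by
  have hm := fun p hp l => P.matching p hp q hq (.slash x y) l 1
  rcases P.exists_up hR with h1 | h1 | h1 | h1 | h1 | h1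
  · exact absurd (hm _ h1 0 (by simp [PuzzlePiece.sides]) h) (by simp)
  · exact Or.inl h1
  · exact Or.inr h1
  · exact absurd (hm _ h1 0 (by simp [PuzzlePiece.sides]) h) (by simp)
  · exact absurd h1 (notMem_nwse_of_slash hq h)
  · exact absurd (hm _ h1 0 (by simp [PuzzlePiece.sides]) h) (by simp)

lemma isOne_northwest {k : ℕ} (hk : k < a + b) (hw : word a m₁ k = 1) : P.IsOne 0 k := by
  have hm := fun p hp l h => (P.northwest p hp k l hk h).trans hw
  rcases P.exists_up (x := 0) (y := k) (up_mem_bigTriangle.2 ⟨le_rfl, by omega, by omega⟩)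
    with h1 | h1 | h1 | h1 | h1 | h1
  · exact absurd (hm _ h1 0 (by simp [PuzzlePiece.sides])) (by simp)
  · exact Or.inl h1
  · exact Or.inr h1
  · exact absurd (hm _ h1 0 (by simp [PuzzlePiece.sides])) (by simp)
  · have := down_of_mem (x := 0 - 1) h1 (Or.inr rfl)
    omega
  · exact absurd (hm _ h1 0 (by simp [PuzzlePiece.sides])) (by simp)

/-- A downward triangle below an edge with label `1`. -/
lemma below_one {q : PuzzlePiece} (hR : Tri.down x y ∈ bigTriangle (a + b))
    (hn : ⟨.rhombus .nesw, x, y⟩ ∉ P.pieces) (hq : q ∈ P.pieces)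
    (hc : Tri.up x (y + 1) ∈ q.cells) (h : (.horiz x (y + 1), 1) ∈ q.sides) :
    ⟨.downTri 1, x, y⟩ ∈ P.pieces := by
  have hm := fun p hp l => P.matching p hp q hq (.horiz x (y + 1)) l 1
  rcases P.exists_down hR with h1 | h1 | h1 | h1 | h1 | h1
  · exact absurd (hm _ h1 0 (by simp [PuzzlePiece.sides]) h) (by simp)
  · exact h1
  · rw [unique hq h1 hc (Or.inl rfl)] at h
    simp [PuzzlePiece.sides] at h
  · rw [unique hq h1 hc (Or.inl rfl)] at h
    simp [PuzzlePiece.sides] at h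
  · exact absurd (hm _ h1 0 (by simp [PuzzlePiece.sides]) h) (by simp)
  · exact absurd h1 hn

/-- A label `1` on a left side travels down its strip: through a vertical rhombus directly, or
through an upward triangle followed by the downward triangle below it. Only a NE-SW rhombus could
interrupt this. -/
lemma isOne_step (hy : 0 ≤ y) (hn : ⟨.rhombus .nesw, x, y⟩ ∉ P.pieces)
    (h : P.IsOne x (y + 1)) : P.IsOne (x + 1) y ∧
      (⟨.downTri 1, x, y⟩ ∈ P.pieces ∨ ⟨.rhombus .vertical, x, y + 1⟩ ∈ P.pieces) := by
  rcases h with h | h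
  · have h1 := up_of_mem h rfl
    have h2 := below_one (down_mem_bigTriangle.2 (by push_cast; omega)) hn h rfl
      (by simp [PuzzlePiece.sides])
    exact ⟨isOne_of_slash (up_mem_bigTriangle.2 (by push_cast; omega)) h2
      (by simp [PuzzlePiece.sides]), Or.inl h2⟩
  · have h1 := up_of_mem h (Or.inl rfl)
    exact ⟨isOne_of_slash (up_mem_bigTriangle.2 (by push_cast; omega)) h
      (by simp [PuzzlePiece.sides]), Or.inr h⟩

lemma word_of_isOne {k : ℕ} (hn : ∀ x y : ℤ, x + y + 1 = k → ⟨.rhombus .nesw, x, y⟩ ∉ P.pieces)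
    {y : ℕ} (hk : x + y = k) (h : P.IsOne x y) : word a m₃ k = 1 := by
  induction y generalizing x with
  | zero =>
    rcases h with h | h
    · have h1 := up_of_mem h rfl
      obtain rfl : x = k := by omega
      exact (P.bottom _ h k 1 (by omega) (by simp [PuzzlePiece.sides])).symm
    · have := down_of_mem (y := ((0 : ℕ) : ℤ) - 1) h (Or.inr rfl)
      omega
  | succ y ih =>
    push_cast at hk h
    exact ih (by omega) (isOne_step (by omega) (hn _ _ (by omega)) h).1

lemma isOne_strip {k : ℕ} (hn : ∀ x y : ℤ, x + y + 1 = k → ⟨.rhombus .nesw, x, y⟩ ∉ P.pieces)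
    (hk : k < a + b) (hw : word a m₁ k = 1) {x : ℕ} (hx : x ≤ k) : P.IsOne x (k - x) := by
  induction x with
  | zero => simpa using isOne_northwest hk hw
  | succ x ih =>
    have h1 := ih (by omega)
    rw [show (k : ℤ) - x = (k - (x + 1 : ℕ)) + 1 by push_cast; ring] at h1
    simpa using (isOne_step (by omega) (hn _ _ (by omega)) h1).1

end basic

/-! ### Every strip carries a single letter -/

section structureTheorem

variable {a b : ℕ} {lam mu : YoungDiagram} {P : Puzzle a b lam mu lam} {x y : ℤ}

lemma isOne_ne {κ : PieceKind} (h : P.IsOne x y) (h' : ⟨κ, x, y⟩ ∈ P.pieces)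
    (hκ : Tri.up x y ∈ (⟨κ, x, y⟩ : PuzzlePiece).cells) : κ = .upTri 1 ∨ κ = .rhombus .vertical :=
  h.imp (fun h => up_unique h' h hκ rfl) (fun h => up_unique h' h hκ (Or.inl rfl))

/-- No rhombus with horizontal sides and long diagonal NE-SW occurs in a puzzle whose NW side and
bottom side have the same word. -/
lemma nesw_notMem : ⟨.rhombus .nesw, x, y⟩ ∉ P.pieces := by
  suffices H : ∀ (k : ℕ) (x y : ℤ), x + y + 1 = k → ⟨.rhombus .nesw, x, y⟩ ∉ P.pieces by
    intro h
    have := up_of_mem h (Or.inl rfl)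
    exact H (x + y + 1).toNat x y (by omega) h
  intro k
  induction k with
  | zero =>
    intro x y hk h
    have := up_of_mem h (Or.inl rfl)
    push_cast at hk
    omega
  -- Such a rhombus crosses the line between strips `k` and `k + 1`. By induction none crosses the
  -- left line of strip `k`, so labels `1` propagate down it. If the letter is `1`, the left side
  -- `0` of the rhombus contradicts propagation from the NW side; if not, the `1` on its bottom
  -- propagates to the bottom side of the triangle.
  | succ k ih =>
    intro x y hk h
    have h1 := up_of_mem h (Or.inl rfl)
    push_cast at hk
    obtain ⟨h2, h3, h4⟩ := h1
    lift x to ℕ using h2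
    lift y to ℕ using h3
    by_cases hw : word a lam k = 1
    · have h5 := isOne_strip ih (by omega) hw (x := x) (by omega)
      rw [show (k : ℤ) - x = y by omega] at h5
      simpa using isOne_ne h5 h (Or.inl rfl)
    · apply hw
      cases y with
      | zero =>
        obtain rfl : x = k := by omega
        exact (P.bottom _ h x 1 (by omega) (by simp [PuzzlePiece.sides])).symm
      | succ y =>
        push_cast at hk h h4
        have h5 := below_one (down_mem_bigTriangle.2 (by push_cast; omega))
          (ih x y (by omega)) h (Or.inl rfl) (by simp [PuzzlePiece.sides])
        have h6 := isOne_of_slash (x := x + 1) (y := y) (up_mem_bigTriangle.2 (by push_cast; omega)) h5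
          (by simp [PuzzlePiece.sides])
        exact word_of_isOne ih (by omega) h6

/-- The left sides of the upward triangles in strip `k` have label `1` iff the `k`-th letter of the
word is `1`. -/
lemma isOne_iff {k : ℕ} (hk : x + y = k) (hR : Tri.up x y ∈ bigTriangle (a + b)) :
    P.IsOne x y ↔ word a lam k = 1 := by
  obtain ⟨h1, h2, h3⟩ := up_mem_bigTriangle.1 hR
  lift x to ℕ using h1
  lift y to ℕ using h2
  constructor
  · exact word_of_isOne (fun _ _ _ => nesw_notMem) hk
  · intro hw
    have := isOne_strip (P := P) (fun _ _ _ => nesw_notMem) (by omega) hw (x := x) (by omega)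
    rwa [show (k : ℤ) - x = y by omega] at this

/-- A left side labeled `0` and the absence of NE-SW rhombi leave three pieces, which exclude each
other. They are the counterpart of the three lozenges through a triangle of `∇`. -/
lemma up_zero {k : ℕ} (hk : x + y = k) (hR : Tri.up x y ∈ bigTriangle (a + b))
    (hw : word a lam k = 0) :
    (⟨.upTri 0, x, y⟩ ∈ P.pieces ∧ ⟨.equivariant, x, y⟩ ∉ P.pieces ∧
      ⟨.rhombus .nwse, x, y⟩ ∉ P.pieces) ∨
    (⟨.upTri 0, x, y⟩ ∉ P.pieces ∧ ⟨.equivariant, x, y⟩ ∈ P.pieces ∧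
      ⟨.rhombus .nwse, x, y⟩ ∉ P.pieces) ∨
    (⟨.upTri 0, x, y⟩ ∉ P.pieces ∧ ⟨.equivariant, x, y⟩ ∉ P.pieces ∧
      ⟨.rhombus .nwse, x, y⟩ ∈ P.pieces) := by
  have h1 : ¬ P.IsOne x y := by
    rw [isOne_iff hk hR, hw]
    simp
  have e : ∀ {κ κ'} (_ : ⟨κ, x, y⟩ ∈ P.pieces) (_ : ⟨κ', x, y⟩ ∈ P.pieces), _ → _ → κ = κ' :=
    fun h h' => up_unique h h'
  rcases P.exists_up hR with h | h | h | h | h | h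
  · refine Or.inl ⟨h, fun h' => ?_, fun h' => ?_⟩
    · simpa using e h h' rfl (Or.inl rfl)
    · simpa using e h h' rfl (Or.inl rfl)
  · exact absurd (Or.inl h) h1
  · exact absurd (Or.inr h) h1
  · refine Or.inr (Or.inl ⟨fun h' => ?_, h, fun h' => ?_⟩)
    · simpa using e h h' (Or.inl rfl) rfl
    · simpa using e h h' (Or.inl rfl) (Or.inl rfl)
  · refine Or.inr (Or.inr ⟨fun h' => ?_, fun h' => ?_, h⟩)
    · simpa using e h h' (Or.inl rfl) rfl
    · simpa using e h h' (Or.inl rfl) (Or.inl rfl)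
  · exact absurd h nesw_notMem

lemma down_zero {k : ℕ} (hk : x + y + 1 = k) (hR : Tri.down x y ∈ bigTriangle (a + b))
    (hw : word a lam k = 0) :
    (⟨.downTri 0, x, y⟩ ∈ P.pieces ∧ ⟨.equivariant, x, y + 1⟩ ∉ P.pieces ∧
      ⟨.rhombus .nwse, x + 1, y⟩ ∉ P.pieces) ∨
    (⟨.downTri 0, x, y⟩ ∉ P.pieces ∧ ⟨.equivariant, x, y + 1⟩ ∈ P.pieces ∧
      ⟨.rhombus .nwse, x + 1, y⟩ ∉ P.pieces) ∨
    (⟨.downTri 0, x, y⟩ ∉ P.pieces ∧ ⟨.equivariant, x, y + 1⟩ ∉ P.pieces ∧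
      ⟨.rhombus .nwse, x + 1, y⟩ ∈ P.pieces) := by
  have hb := down_mem_bigTriangle.1 hR
  have h1 : ¬ P.IsOne x (y + 1) := by
    rw [isOne_iff (k := k) (by omega) (up_mem_bigTriangle.2 (by omega)), hw]
    simp
  have h2 : ¬ P.IsOne (x + 1) y := by
    rw [isOne_iff (k := k) (by omega) (up_mem_bigTriangle.2 (by omega)), hw]
    simp
  have c1 : ∀ v, Tri.down x y ∈ (⟨.equivariant, x, v⟩ : PuzzlePiece).cells ↔ v = y + 1 := by
    intro v
    simp only [PuzzlePiece.cells, rhombusCells]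
    simp
    omega
  have c2 : Tri.down x y ∈ (⟨.equivariant, x, y + 1⟩ : PuzzlePiece).cells := (c1 _).2 rfl
  have c3 : Tri.down x y ∈ (⟨.rhombus .nwse, x + 1, y⟩ : PuzzlePiece).cells := by
    simp [PuzzlePiece.cells, rhombusCells]
  have c4 : Tri.down x y ∈ (⟨.downTri 0, x, y⟩ : PuzzlePiece).cells := rfl
  rcases P.exists_down hR with h | h | h | h | h | h
  · refine Or.inl ⟨h, fun h' => ?_, fun h' => ?_⟩
    · simpa using unique h h' c4 c2
    · simpa using unique h h' c4 c3
  · exact absurd (isOne_of_slash (up_mem_bigTriangle.2 (by omega)) h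
      (by simp [PuzzlePiece.sides])) h2
  · exact absurd (Or.inr h) h1
  · refine Or.inr (Or.inl ⟨fun h' => ?_, h, fun h' => ?_⟩)
    · simpa using unique h h' c2 c4
    · simpa using unique h h' c2 c3
  · refine Or.inr (Or.inr ⟨fun h' => ?_, fun h' => ?_, h⟩)
    · simpa using unique h h' c3 c4
    · simpa using unique h h' c3 c2
  · exact absurd h nesw_notMem

/-- The edge `back x y` has label `0`. -/
def IsZero (P : Puzzle a b lam mu lam) (x y : ℤ) : Prop :=
  ∃ p ∈ P.pieces, (.back x y, 0) ∈ p.sides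

lemma isZero_iff_up (hR : Tri.up x y ∈ bigTriangle (a + b)) :
    P.IsZero x y ↔ ⟨.upTri 0, x, y⟩ ∈ P.pieces ∨ ⟨.rhombus .vertical, x, y⟩ ∈ P.pieces := by
  constructor
  · rintro ⟨q, hq, h⟩
    have hm := fun p hp l => P.matching p hp q hq (.back x y) l 0
    rcases P.exists_up hR with h1 | h1 | h1 | h1 | h1 | h1
    · exact Or.inl h1
    · exact absurd (hm _ h1 1 (by simp [PuzzlePiece.sides]) h) (by simp)
    · exact Or.inr h1
    · exact absurd (hm _ h1 1 (by simp [PuzzlePiece.sides]) h) (by simp)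
    · exact absurd (hm _ h1 1 (by simp [PuzzlePiece.sides]) h) (by simp)
    · exact absurd h1 nesw_notMem
  · rintro (h | h) <;> exact ⟨_, h, by simp [PuzzlePiece.sides]⟩

lemma isZero_iff_down (hR : Tri.down x y ∈ bigTriangle (a + b)) :
    P.IsZero x y ↔ ⟨.downTri 0, x, y⟩ ∈ P.pieces ∨
      ⟨.rhombus .vertical, x, y + 1⟩ ∈ P.pieces := by
  constructor
  · rintro ⟨q, hq, h⟩
    have hm := fun p hp l => P.matching p hp q hq (.back x y) l 0
    rcases P.exists_down hR with h1 | h1 | h1 | h1 | h1 | h1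
    · exact Or.inl h1
    · exact absurd (hm _ h1 1 (by simp [PuzzlePiece.sides]) h) (by simp)
    · exact Or.inr h1
    · exact absurd (hm _ h1 1 (by simp [PuzzlePiece.sides]) h) (by simp)
    · exact absurd (hm _ h1 1 (by simp [PuzzlePiece.sides]) h) (by simp)
    · exact absurd h1 nesw_notMem
  · rintro (h | h) <;> exact ⟨_, h, by simp [PuzzlePiece.sides]⟩

end structureTheorem

end Puzzle

/-- Positions on the boundary path are beads shifted by `a`. The beads of rows from `a` on lie left
of `-a` and correspond to no letter. -/
lemma word_eq_zero_iff_isBead {a k : ℕ} {m : YoungDiagram} (hm : ∀ i, a ≤ i → m.rowLen i = 0) :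
    word a m k = 0 ↔ IsBead m (k - a) := by
  rw [word_eq_zero_iff]
  constructor
  · rintro ⟨i, hi, rfl⟩
    refine ⟨i, ?_⟩
    rw [zeroPos]
    omega
  · rintro ⟨i, hi⟩
    rcases Nat.lt_or_ge i a with h | h
    · refine ⟨i, h, ?_⟩
      rw [zeroPos]
      omega
    · rw [hm i h] at hi
      omega

lemma isBead_of_lt_neg {a : ℕ} {m : YoungDiagram} (hm : ∀ i, a ≤ i → m.rowLen i = 0) {x : ℤ}
    (hx : x < -a) : IsBead m x :=
  ⟨(-x - 1).toNat, by rw [hm _ (by omega)]; omega⟩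

/-! ### The puzzle of a height function -/

namespace HeightFunction

variable {lam mu : YoungDiagram} {a b : ℕ} (H : HeightFunction lam mu a)

/-- The label at position `x` of the line between the strips `k - 1` and `k` of the puzzle of `H`
is `0`. -/
def LineZero (x : ℤ) (k : ℕ) : Prop :=
  H.val (x - zeroCount a lam k) (zeroCount a lam k) =
    H.val (x - zeroCount a lam k + 1) (zeroCount a lam k) + 1

lemma lineZero_succ_of_one {x : ℤ} {k : ℕ} (h : word a lam k = 1) :
    H.LineZero x (k + 1) ↔ H.LineZero x k := by
  rw [LineZero, LineZero, zeroCount_succ_of_one h]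

lemma lineZero_succ_of_zero {x : ℤ} {k : ℕ} (h : word a lam k = 0) :
    H.LineZero x (k + 1) ↔ H.val (x - zeroCount a lam k - 1) (zeroCount a lam k + 1) =
      H.val (x - zeroCount a lam k) (zeroCount a lam k + 1) + 1 := by
  rw [LineZero, zeroCount_succ_of_zero h, Nat.cast_succ,
    show x - (zeroCount a lam k + 1 : ℤ) = x - zeroCount a lam k - 1 by ring, sub_add_cancel]

/-- The last zero before position `k` bounds the beads of the current row. This keeps vertical
rhombi from sticking out below the bottom side. -/
lemma not_lineZero {x : ℤ} {k : ℕ} (h : (k : ℤ) ≤ x) : ¬ H.LineZero x k := by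
  obtain ⟨h1, h2, -, -⟩ := zeroCount_spec (a := a) (m := lam) k
  rw [LineZero]
  generalize zeroCount a lam k = c at h1 h2 ⊢
  cases c with
  | zero =>
    rw [H.val_zero]
    omega
  | succ c =>
    have h3 := h2 c rfl
    rw [zeroAt] at h3
    rw [H.val_succ_eq_zero (x - (c + 1 : ℕ)) c (by omega) (by omega)]
    omega

/-- The pieces of the puzzle of a height function. -/
def IsPiece (b : ℕ) (p : PuzzlePiece) : Prop :=
  p.cells ⊆ bigTriangle (a + b) ∧ match p.kind with
    | .upTri l => ∃ k : ℕ, p.x + p.y = k ∧ word a lam k = l ∧ (H.LineZero p.x (k + 1) ↔ l = 0)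
    | .downTri l => ∃ k : ℕ, p.x + p.y + 1 = k ∧ word a lam k = l ∧ (H.LineZero p.x k ↔ l = 0)
    | .rhombus .vertical => ∃ k : ℕ, p.x + p.y = k ∧ word a lam k = 1 ∧ H.LineZero p.x k
    | .rhombus .nwse => ∃ k : ℕ, p.x + p.y = k ∧ word a lam k = 0 ∧
        H.val (p.x - zeroCount a lam k - 1) (zeroCount a lam k + 1) =
          H.val (p.x - zeroCount a lam k) (zeroCount a lam k)
    | .rhombus .nesw => False
    | .equivariant => ∃ k : ℕ, p.x + p.y = k ∧ word a lam k = 0 ∧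
        H.val (p.x - zeroCount a lam k) (zeroCount a lam k + 1) =
          H.val (p.x - zeroCount a lam k) (zeroCount a lam k) + 1

section isPiece

variable {x y : ℤ} {k : ℕ}

lemma exists_natCast_eq_and {p : ℕ → Prop} {z : ℤ} (hk : z = k) :
    (∃ j : ℕ, z = j ∧ p j) ↔ p k := by
  subst hk
  simp

lemma isPiece_upTri {l : Fin 2} (hk : x + y = k) : H.IsPiece b ⟨.upTri l, x, y⟩ ↔
    Tri.up x y ∈ bigTriangle (a + b) ∧ word a lam k = l ∧ (H.LineZero x (k + 1) ↔ l = 0) := by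
  simp only [IsPiece, exists_natCast_eq_and hk, PuzzlePiece.cells, Set.singleton_subset_iff]

lemma isPiece_downTri {l : Fin 2} (hk : x + y + 1 = k) : H.IsPiece b ⟨.downTri l, x, y⟩ ↔
    Tri.down x y ∈ bigTriangle (a + b) ∧ word a lam k = l ∧ (H.LineZero x k ↔ l = 0) := by
  simp only [IsPiece, exists_natCast_eq_and hk, PuzzlePiece.cells, Set.singleton_subset_iff]

lemma isPiece_vertical (hk : x + y = k) : H.IsPiece b ⟨.rhombus .vertical, x, y⟩ ↔
    (0 ≤ x ∧ 1 ≤ y ∧ k < a + b) ∧ word a lam k = 1 ∧ H.LineZero x k := by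
  simp only [IsPiece, exists_natCast_eq_and hk, PuzzlePiece.cells, rhombusCells,
    Set.insert_subset_iff, Set.singleton_subset_iff, up_mem_bigTriangle, down_mem_bigTriangle]
  refine and_congr_left fun _ => ?_
  push_cast
  omega

lemma isPiece_equivariant (hk : x + y = k) : H.IsPiece b ⟨.equivariant, x, y⟩ ↔
    (0 ≤ x ∧ 1 ≤ y ∧ k < a + b) ∧ word a lam k = 0 ∧
      H.val (x - zeroCount a lam k) (zeroCount a lam k + 1) =
        H.val (x - zeroCount a lam k) (zeroCount a lam k) + 1 := by
  simp only [IsPiece, exists_natCast_eq_and hk, PuzzlePiece.cells, rhombusCells,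
    Set.insert_subset_iff, Set.singleton_subset_iff, up_mem_bigTriangle, down_mem_bigTriangle]
  refine and_congr_left fun _ => ?_
  push_cast
  omega

lemma isPiece_nwse (hk : x + y = k) : H.IsPiece b ⟨.rhombus .nwse, x, y⟩ ↔
    (1 ≤ x ∧ 0 ≤ y ∧ k < a + b) ∧ word a lam k = 0 ∧
      H.val (x - zeroCount a lam k - 1) (zeroCount a lam k + 1) =
        H.val (x - zeroCount a lam k) (zeroCount a lam k) := by
  simp only [IsPiece, exists_natCast_eq_and hk, PuzzlePiece.cells, rhombusCells,
    Set.insert_subset_iff, Set.singleton_subset_iff, up_mem_bigTriangle, down_mem_bigTriangle]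
  refine and_congr_left fun _ => ?_
  push_cast
  omega

lemma not_isPiece_nesw : ¬ H.IsPiece b ⟨.rhombus .nesw, x, y⟩ := fun h => h.2

/-- In a strip of letter `0` this is the gap argument for tilings, with upward and downward
triangles exchanged. In a strip of letter `1` the label of the line alone decides between a vertical
rhombus and a triangle. -/
lemma existsUnique_isPiece {s : Tri} (hs : s ∈ bigTriangle (a + b)) :
    ∃! p, H.IsPiece b p ∧ s ∈ p.cells := by
  rcases s with ⟨x, y⟩ | ⟨x, y⟩
  · simp only [up_mem_piece_iff]
    have hb := up_mem_bigTriangle.1 hs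
    obtain ⟨k, hk⟩ := Int.eq_ofNat_of_zero_le (show 0 ≤ x + y by omega)
    have c1 := fun l => H.isPiece_upTri (b := b) (l := l) hk
    have c2 := H.isPiece_vertical (b := b) hk
    have c3 := H.isPiece_equivariant (b := b) hk
    have c4 := H.isPiece_nwse (b := b) hk
    have c5 := H.not_isPiece_nesw (b := b) (x := x) (y := y)
    have hend := H.not_lineZero (x := x) (k := k)
    simp only [hs, true_and] at c1
    by_cases hw : word a lam k = 1
    · rw [H.lineZero_succ_of_one hw] at c1
      simp only [hw, true_and, one_ne_zero, iff_false, false_and, and_false] at c1 c2 c3 c4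
      by_cases hz : H.LineZero x k
      · refine ⟨⟨.rhombus .vertical, x, y⟩, ⟨c2.2 ⟨⟨hb.1, ?_, by omega⟩, hz⟩, by simp⟩, ?_⟩
        · by_contra hy
          exact hend (by omega) hz
        · rintro p ⟨hp, rfl | rfl | rfl | rfl | rfl | rfl⟩ <;> simp_all
      · refine ⟨⟨.upTri 1, x, y⟩, ⟨(c1 1).2 (by simp [hz]), by simp⟩, ?_⟩
        rintro p ⟨hp, rfl | rfl | rfl | rfl | rfl | rfl⟩ <;> simp_all
    · rw [word_eq_one_iff, not_not] at hw
      obtain ⟨hc, hkc⟩ := (zeroCount_spec k).2.2.2 hw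
      have c1 := fun l => (c1 l).trans (and_congr_right fun _ =>
        iff_congr (H.lineZero_succ_of_zero hw) Iff.rfl)
      simp only [hw, true_and, zero_ne_one, false_and, and_false] at c1 c2 c3 c4
      have e1 := H.val_add_one_le (x - zeroCount a lam k - 1) (zeroCount a lam k + 1)
      have e2 := H.le_val_succ (x - zeroCount a lam k) (zeroCount a lam k)
      have e3 := H.val_succ_le (x - zeroCount a lam k - 1) (zeroCount a lam k)
      rw [sub_add_cancel] at e1 e3
      by_cases hE : H.val (x - zeroCount a lam k) (zeroCount a lam k + 1) =
          H.val (x - zeroCount a lam k) (zeroCount a lam k) + 1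
      -- The right bound on increments leaves room for the lower half of the piece above the bottom
      -- side.
      · have hst := H.step_bounds hc hE
        rw [zeroAt] at hkc
        refine ⟨⟨.equivariant, x, y⟩, ⟨c3.2 ⟨⟨hb.1, by omega, by omega⟩, hE⟩, by simp⟩, ?_⟩
        rintro p ⟨hp, rfl | rfl | rfl | rfl | rfl | rfl⟩
        · have := (c1 0).1 hp
          simp only [true_and, iff_true] at this
          omega
        · simpa using (c1 1).1 hp
        · exact (c2.1 hp).elim
        · rfl
        · have := (c4.1 hp).2
          omega
        · exact (c5 hp).elim
      · by_cases hN : H.val (x - zeroCount a lam k - 1) (zeroCount a lam k + 1) =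
          H.val (x - zeroCount a lam k) (zeroCount a lam k)
        · refine ⟨⟨.rhombus .nwse, x, y⟩, ⟨c4.2 ⟨⟨?_, hb.2.1, by omega⟩, hN⟩, by simp⟩, ?_⟩
          -- At `x = 0` the rhombus would cross the NW side; the frozen heights there differ by 1.
          · by_contra hx
            rw [H.val_of_le_neg _ _ (by push_cast; omega),
              H.val_of_le_neg _ _ (by omega)] at hN
            omega
          · rintro p ⟨hp, rfl | rfl | rfl | rfl | rfl | rfl⟩
            · have := (c1 0).1 hp
              simp only [true_and, iff_true] at this
              omega
            · simpa using (c1 1).1 hp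
            · exact (c2.1 hp).elim
            · exact absurd (c3.1 hp).2 hE
            · rfl
            · exact (c5 hp).elim
        · refine ⟨⟨.upTri 0, x, y⟩, ⟨(c1 0).2 ?_, by simp⟩, ?_⟩
          · simp only [true_and, iff_true]
            omega
          · rintro p ⟨hp, rfl | rfl | rfl | rfl | rfl | rfl⟩
            · rfl
            · simpa using (c1 1).1 hp
            · exact (c2.1 hp).elim
            · exact absurd (c3.1 hp).2 hE
            · exact absurd (c4.1 hp).2 hN
            · exact (c5 hp).elim
  · simp only [down_mem_piece_iff]
    have hb := down_mem_bigTriangle.1 hs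
    obtain ⟨k, hk⟩ := Int.eq_ofNat_of_zero_le (show 0 ≤ x + y + 1 by omega)
    have c1 := fun l => H.isPiece_downTri (b := b) (l := l) hk
    have c2 := H.isPiece_vertical (b := b) (x := x) (y := y + 1) (k := k) (by omega)
    have c3 := H.isPiece_equivariant (b := b) (x := x) (y := y + 1) (k := k) (by omega)
    have c4 := H.isPiece_nwse (b := b) (x := x + 1) (y := y) (k := k) (by omega)
    have c5 := H.not_isPiece_nesw (b := b) (x := x) (y := y)
    simp only [hs, true_and] at c1
    by_cases hw : word a lam k = 1
    · simp only [hw, true_and, one_ne_zero, iff_false, false_and, and_false] at c1 c2 c3 c4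
      by_cases hz : H.LineZero x k
      · refine ⟨⟨.rhombus .vertical, x, y + 1⟩,
          ⟨c2.2 ⟨⟨hb.1, by omega, by omega⟩, hz⟩, by simp⟩, ?_⟩
        rintro p ⟨hp, rfl | rfl | rfl | rfl | rfl | rfl⟩ <;> simp_all
      · refine ⟨⟨.downTri 1, x, y⟩, ⟨(c1 1).2 (by simp [hz]), by simp⟩, ?_⟩
        rintro p ⟨hp, rfl | rfl | rfl | rfl | rfl | rfl⟩ <;> simp_all
    · rw [word_eq_one_iff, not_not] at hw
      obtain ⟨hc, hkc⟩ := (zeroCount_spec k).2.2.2 hw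
      simp only [hw, true_and, zero_ne_one, false_and, and_false, LineZero] at c1 c2 c3 c4
      rw [show x + 1 - zeroCount a lam k - 1 = x - zeroCount a lam k by ring,
        show x + 1 - zeroCount a lam k = x - zeroCount a lam k + 1 by ring] at c4
      have e1 := H.val_add_one_le (x - zeroCount a lam k) (zeroCount a lam k)
      have e2 := H.le_val_succ (x - zeroCount a lam k) (zeroCount a lam k)
      have e3 := H.val_succ_le (x - zeroCount a lam k) (zeroCount a lam k)
      by_cases hE : H.val (x - zeroCount a lam k) (zeroCount a lam k + 1) =
          H.val (x - zeroCount a lam k) (zeroCount a lam k) + 1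
      · refine ⟨⟨.equivariant, x, y + 1⟩,
          ⟨c3.2 ⟨⟨hb.1, by omega, by omega⟩, hE⟩, by simp⟩, ?_⟩
        rintro p ⟨hp, rfl | rfl | rfl | rfl | rfl | rfl⟩
        · have := (c1 0).1 hp
          simp only [true_and, iff_true] at this
          omega
        · simpa using (c1 1).1 hp
        · exact (c2.1 hp).elim
        · rfl
        · have := (c4.1 hp).2
          omega
        · exact (c5 hp).elim
      · by_cases hN : H.val (x - zeroCount a lam k) (zeroCount a lam k + 1) =
          H.val (x - zeroCount a lam k + 1) (zeroCount a lam k)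
        · refine ⟨⟨.rhombus .nwse, x + 1, y⟩,
            ⟨c4.2 ⟨⟨by omega, hb.2.1, by omega⟩, hN⟩, by simp⟩, ?_⟩
          rintro p ⟨hp, rfl | rfl | rfl | rfl | rfl | rfl⟩
          · have := (c1 0).1 hp
            simp only [true_and, iff_true] at this
            omega
          · simpa using (c1 1).1 hp
          · exact (c2.1 hp).elim
          · exact absurd (c3.1 hp).2 hE
          · rfl
          · exact (c5 hp).elim
        · refine ⟨⟨.downTri 0, x, y⟩, ⟨(c1 0).2 ?_, by simp⟩, ?_⟩
          · simp only [true_and, iff_true]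
            omega
          · rintro p ⟨hp, rfl | rfl | rfl | rfl | rfl | rfl⟩
            · rfl
            · simpa using (c1 1).1 hp
            · exact (c2.1 hp).elim
            · exact absurd (c3.1 hp).2 hE
            · exact absurd (c4.1 hp).2 hN
            · exact (c5 hp).elim

open Classical in
/-- The labels of the edges in the puzzle of a height function. -/
noncomputable def edgeLabel (e : Edge) : Fin 2 :=
  match e with
  | .horiz x y => word a lam (x + y).toNat
  | .slash x y => word a lam (x + y).toNat
  | .back x y => if H.LineZero x (x + y + 1).toNat then 0 else 1

lemma edgeLabel_horiz (hk : x + y = k) : H.edgeLabel (.horiz x y) = word a lam k := by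
  simp [edgeLabel, hk]

lemma edgeLabel_slash (hk : x + y = k) : H.edgeLabel (.slash x y) = word a lam k := by
  simp [edgeLabel, hk]

lemma edgeLabel_back_of (hk : x + y + 1 = k) (h : H.LineZero x k) :
    H.edgeLabel (.back x y) = 0 := by
  simp [edgeLabel, hk, h]

lemma edgeLabel_back_of_not (hk : x + y + 1 = k) (h : ¬ H.LineZero x k) :
    H.edgeLabel (.back x y) = 1 := by
  simp [edgeLabel, hk, h]

lemma edgeLabel_back {l : Fin 2} (hk : x + y + 1 = k) (h : H.LineZero x k ↔ l = 0) :
    H.edgeLabel (.back x y) = l := by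
  by_cases hl : l = 0
  · rw [H.edgeLabel_back_of hk (h.2 hl), hl]
  · rw [H.edgeLabel_back_of_not hk (mt h.1 hl)]
    fin_cases l <;> simp_all

/-- Since all labels come from one function on edges, matching is automatic and the boundary
conditions reduce to evaluating that function. -/
lemma edgeLabel_of_isPiece {p : PuzzlePiece} (hp : H.IsPiece b p) {e : Edge} {l : Fin 2}
    (he : (e, l) ∈ p.sides) : l = H.edgeLabel e := by
  rcases p with ⟨κ, x, y⟩
  rcases κ with l' | l' | o | _
  · obtain ⟨-, k, hk, hw, hz⟩ := hp
    simp only at hk hz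
    simp only [PuzzlePiece.sides, List.mem_cons, Prod.mk.injEq, List.not_mem_nil, or_false] at he
    rcases he with ⟨rfl, rfl⟩ | ⟨rfl, rfl⟩ | ⟨rfl, rfl⟩
    · rw [H.edgeLabel_horiz hk, hw]
    · rw [H.edgeLabel_slash hk, hw]
    · rw [H.edgeLabel_back (k := k + 1) (by push_cast; omega) hz]
  · obtain ⟨-, k, hk, hw, hz⟩ := hp
    simp only at hk hz
    simp only [PuzzlePiece.sides, List.mem_cons, Prod.mk.injEq, List.not_mem_nil, or_false] at he
    rcases he with ⟨rfl, rfl⟩ | ⟨rfl, rfl⟩ | ⟨rfl, rfl⟩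
    · rw [H.edgeLabel_horiz (k := k) (by omega), hw]
    · rw [H.edgeLabel_slash (k := k) (by omega), hw]
    · rw [H.edgeLabel_back hk hz]
  · cases o
    · obtain ⟨-, k, hk, hw, hz⟩ := hp
      simp only at hk hz
      simp only [PuzzlePiece.sides, List.mem_cons, Prod.mk.injEq, List.not_mem_nil,
        or_false] at he
      rcases he with ⟨rfl, rfl⟩ | ⟨rfl, rfl⟩ | ⟨rfl, rfl⟩ | ⟨rfl, rfl⟩
      · rw [H.edgeLabel_slash hk, hw]
      · rw [H.edgeLabel_slash (k := k) (by omega), hw]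
      · rw [H.edgeLabel_back_of (k := k + 1) (by push_cast; omega)
          ((H.lineZero_succ_of_one hw).2 hz)]
      · rw [H.edgeLabel_back_of (k := k) (by omega) hz]
    · obtain ⟨-, k, hk, hw, hz⟩ := hp
      simp only at hk hz
      simp only [PuzzlePiece.sides, List.mem_cons, Prod.mk.injEq, List.not_mem_nil,
        or_false] at he
      have e1 := H.val_add_one_le (x - zeroCount a lam k - 1) (zeroCount a lam k)
      have e2 := H.le_val_succ (x - zeroCount a lam k) (zeroCount a lam k)
      have e3 := H.le_val_succ (x - zeroCount a lam k - 1) (zeroCount a lam k)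
      rw [sub_add_cancel] at e1
      rcases he with ⟨rfl, rfl⟩ | ⟨rfl, rfl⟩ | ⟨rfl, rfl⟩ | ⟨rfl, rfl⟩
      · rw [H.edgeLabel_back_of_not (k := k) (by omega)]
        rw [LineZero, sub_right_comm, sub_add_cancel]
        omega
      · rw [H.edgeLabel_back_of_not (k := k + 1) (by push_cast; omega)]
        rw [H.lineZero_succ_of_zero hw]
        omega
      · rw [H.edgeLabel_horiz hk, hw]
      · rw [H.edgeLabel_horiz (k := k) (by omega), hw]
    · exact hp.2.elim
  · obtain ⟨-, k, hk, hw, hz⟩ := hp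
    simp only at hk hz
    simp only [PuzzlePiece.sides, List.mem_cons, Prod.mk.injEq, List.not_mem_nil, or_false] at he
    have e1 := H.val_succ_le (x - zeroCount a lam k - 1) (zeroCount a lam k)
    have e2 := H.val_succ_le (x - zeroCount a lam k) (zeroCount a lam k)
    rw [sub_add_cancel] at e1
    rcases he with ⟨rfl, rfl⟩ | ⟨rfl, rfl⟩ | ⟨rfl, rfl⟩ | ⟨rfl, rfl⟩
    · rw [H.edgeLabel_slash hk, hw]
    · rw [H.edgeLabel_slash (k := k) (by omega), hw]
    · rw [H.edgeLabel_back_of_not (k := k + 1) (by push_cast; omega)]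
      rw [H.lineZero_succ_of_zero hw]
      omega
    · rw [H.edgeLabel_back_of_not (k := k) (by omega)]
      rw [LineZero]
      omega

end isPiece

lemma finite_isPiece : {p | H.IsPiece b p}.Finite := by
  have hfin : (Set.range fun o : Option (Fin 2 ⊕ Fin 2 ⊕ Fin 2) => match o with
      | none => PieceKind.equivariant
      | some (.inl l) => .upTri l
      | some (.inr (.inl l)) => .downTri l
      | some (.inr (.inr 0)) => .rhombus .vertical
      | some (.inr (.inr 1)) => .rhombus .nwse).Finite := Set.finite_range _
  refine Set.Finite.subset ((hfin.prod ((Set.finite_Icc (0 : ℤ) (a + b)).prod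
      (Set.finite_Icc (0 : ℤ) (a + b)))).image fun p => ⟨p.1, p.2.1, p.2.2⟩) ?_
  rintro ⟨κ, x, y⟩ hp
  have hup : ∀ s ∈ (⟨κ, x, y⟩ : PuzzlePiece).cells, s = .up x y ∨ s = .down x y →
      (0 ≤ x ∧ x ≤ a + b) ∧ (0 ≤ y ∧ y ≤ a + b) := by
    rintro s hs (rfl | rfl)
    · have := up_mem_bigTriangle.1 (hp.1 hs)
      push_cast at this
      omega
    · have := down_mem_bigTriangle.1 (hp.1 hs)
      push_cast at this
      omega
  rcases κ with l | l | o | _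
  · exact ⟨(_, x, y), ⟨⟨some (.inl l), rfl⟩, hup _ rfl (Or.inl rfl)⟩, rfl⟩
  · exact ⟨(_, x, y), ⟨⟨some (.inr (.inl l)), rfl⟩, hup _ rfl (Or.inr rfl)⟩, rfl⟩
  · cases o
    · exact ⟨(_, x, y), ⟨⟨some (.inr (.inr 0)), rfl⟩, hup _ (Or.inl rfl) (Or.inl rfl)⟩, rfl⟩
    · exact ⟨(_, x, y), ⟨⟨some (.inr (.inr 1)), rfl⟩, hup _ (Or.inl rfl) (Or.inl rfl)⟩, rfl⟩
    · exact hp.2.elim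
  · exact ⟨(_, x, y), ⟨⟨none, rfl⟩, hup _ (Or.inl rfl) (Or.inl rfl)⟩, rfl⟩

/-- The puzzle of a height function. -/
noncomputable def toPuzzle (hm : ∀ i, a ≤ i → mu.rowLen i = 0) (hb : lam.rowLen 0 ≤ b) :
    Puzzle a b lam mu lam where
  pieces := (H.finite_isPiece (b := b)).toFinset
  subset p hp := by
    have : H.IsPiece b p := by simpa using hp
    exact this.1
  cover s hs := by simpa using H.existsUnique_isPiece hs
  matching p hp q hq e l l' h h' :=
    (H.edgeLabel_of_isPiece (b := b) (by simpa using hp) h).trans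
      (H.edgeLabel_of_isPiece (b := b) (by simpa using hq) h').symm
  northwest p hp k l hk h := by
    rw [H.edgeLabel_of_isPiece (b := b) (by simpa using hp) h, H.edgeLabel_slash (zero_add _)]
  northeast p hp k l hk h := by
    rw [H.edgeLabel_of_isPiece (b := b) (by simpa using hp) h]
    -- The NE side is the line after all strips; all `a` zeros have been passed, so it shows the top
    -- row, that is, the beads of `mu`.
    refine H.edgeLabel_back (k := a + b) (by push_cast; ring) ?_
    rw [word_eq_zero_iff_isBead hm, LineZero, zeroCount_add hb]
    exact ⟨H.isBead_of_val le_rfl, H.val_of_isBead le_rfl⟩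
  bottom p hp k l hk h := by
    rw [H.edgeLabel_of_isPiece (b := b) (by simpa using hp) h, H.edgeLabel_horiz (add_zero _)]

lemma mem_toPuzzle {hm : ∀ i, a ≤ i → mu.rowLen i = 0} {hb : lam.rowLen 0 ≤ b}
    {p : PuzzlePiece} : p ∈ (H.toPuzzle hm hb).pieces ↔ H.IsPiece b p := by
  simp [toPuzzle]

/-- Row `y` lives in the strip of the `y`-th zero, and its positions are sheared by `y`. -/
lemma isPiece_equivariant_iff (hb : lam.rowLen 0 ≤ b) {x : ℤ} {y : ℕ} (hy : y < a) :
    H.IsPiece b ⟨.equivariant, x + y, zeroAt a lam y - (x + y)⟩ ↔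
      H.val x (y + 1) = H.val x y + 1 := by
  rw [H.isPiece_equivariant (add_sub_cancel _ _), zeroCount_zeroAt hy, add_sub_cancel_right]
  refine ⟨fun h => h.2.2, fun h => ⟨?_, word_zeroAt hy, h⟩⟩
  have h1 := H.step_bounds hy h
  have h2 := zeroAt_lt_add hb hy
  refine ⟨by omega, ?_, h2⟩
  rw [zeroAt]
  omega

lemma toPuzzle_injective (hm : ∀ i, a ≤ i → mu.rowLen i = 0) (hb : lam.rowLen 0 ≤ b) :
    Function.Injective fun H : HeightFunction lam mu a => H.toPuzzle hm hb := by
  intro H K h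
  refine ext_of_step fun x y hy => ?_
  rw [← H.isPiece_equivariant_iff hb hy, ← K.isPiece_equivariant_iff hb hy,
    ← mem_toPuzzle (hm := hm) (hb := hb), ← mem_toPuzzle (hm := hm) (hb := hb)]
  simp only at h
  rw [h]

end HeightFunction
-- The height function of a puzzle
namespace Puzzle

variable {a b : ℕ} {lam mu : YoungDiagram} {P : Puzzle a b lam mu lam} {x y : ℤ}

lemma isZero_iff_of_mem {p : PuzzlePiece} {l : Fin 2} (hp : p ∈ P.pieces)
    (h : (.back x y, l) ∈ p.sides) : P.IsZero x y ↔ l = 0 := by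
  constructor
  · rintro ⟨q, hq, h'⟩
    exact P.matching p hp q hq _ l 0 h h'
  · rintro rfl
    exact ⟨p, hp, h⟩

lemma nonneg_of_isZero (h : P.IsZero x y) : 0 ≤ x ∧ 0 ≤ y := by
  obtain ⟨p, hp, h⟩ := h
  rcases cells_of_back_mem h with h1 | h1
  · have := up_mem_bigTriangle.1 (P.subset p hp h1)
    omega
  · have := down_mem_bigTriangle.1 (P.subset p hp h1)
    omega

lemma word_of_slash {p : PuzzlePiece} {l : Fin 2} {k : ℕ} (hk : x + y = k)
    (hR : Tri.up x y ∈ bigTriangle (a + b)) (hp : p ∈ P.pieces)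
    (h : (.slash x y, l) ∈ p.sides) : word a lam k = l := by
  by_cases hl : l = 1
  · subst hl
    exact (isOne_iff hk hR).1 (isOne_of_slash hR hp h)
  · by_cases hw : word a lam k = 1
    · rcases (isOne_iff (P := P) hk hR).2 hw with h1 | h1
      · exact absurd (P.matching p hp _ h1 _ l 1 h (by simp [PuzzlePiece.sides])) hl
      · exact absurd (P.matching p hp _ h1 _ l 1 h (by simp [PuzzlePiece.sides])) hl
    · generalize word a lam k = l' at hw
      fin_cases l <;> fin_cases l' <;> simp_all

lemma upTri_zero_notMem {k : ℕ} (hk : x + y = k) (hw : word a lam k = 1) :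
    ⟨.upTri 0, x, y⟩ ∉ P.pieces := fun h => by
  have h1 := word_of_slash (P := P) hk (P.subset _ h rfl) h (l := 0) (by simp [PuzzlePiece.sides])
  simp [hw] at h1

lemma downTri_zero_notMem {k : ℕ} (hk : x + y + 1 = k) (hw : word a lam k = 1) :
    ⟨.downTri 0, x, y⟩ ∉ P.pieces := fun h => by
  have hb := down_of_mem (x := x) (y := y) h rfl
  have h1 := word_of_slash (P := P) (x := x + 1) (y := y) (k := k) (by omega)
    (up_mem_bigTriangle.2 (by push_cast; omega)) h (l := 0) (by simp [PuzzlePiece.sides])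
  simp [hw] at h1

lemma vertical_notMem {k : ℕ} (hk : x + y = k) (hw : word a lam k = 0) :
    ⟨.rhombus .vertical, x, y⟩ ∉ P.pieces := fun h => by
  have h1 := word_of_slash (P := P) hk (P.subset _ h (Or.inl rfl)) h (l := 1)
    (by simp [PuzzlePiece.sides])
  simp [hw] at h1

/-- Strips with label `1` transport the labels of the lines between the strips. -/
lemma isZero_succ_of_one {k : ℕ} (hk : k < a + b) (hw : word a lam k = 1) {x : ℤ} :
    (x < (k + 1 : ℕ) ∧ P.IsZero x ((k + 1 : ℕ) - 1 - x)) ↔ (x < k ∧ P.IsZero x (k - 1 - x)) := by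
  rw [show ((k + 1 : ℕ) : ℤ) - 1 - x = k - x by push_cast; ring]
  rcases lt_or_ge x 0 with h0 | h0
  · constructor <;> rintro ⟨-, h⟩ <;> exact absurd (nonneg_of_isZero h).1 (by omega)
  rcases lt_or_ge (k : ℤ) x with h1 | h1
  · exact ⟨fun h => absurd h.1 (by push_cast; omega), fun h => absurd h.1 (by omega)⟩
  have hup := isZero_iff_up (P := P) (x := x) (y := k - x)
    (up_mem_bigTriangle.2 (by push_cast; omega))
  rw [or_iff_right (upTri_zero_notMem (k := k) (by omega) hw)] at hup
  rw [hup, and_iff_right (by push_cast; omega)]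
  rcases eq_or_lt_of_le h1 with h2 | h2
  · refine ⟨fun h => ?_, fun h => absurd h.1 (by omega)⟩
    have := down_of_mem (y := k - x - 1) h (Or.inr rfl)
    omega
  · have hdn := isZero_iff_down (P := P) (x := x) (y := k - 1 - x)
      (down_mem_bigTriangle.2 (by push_cast; omega))
    rw [or_iff_right (downTri_zero_notMem (k := k) (by omega) hw),
      show (k : ℤ) - 1 - x + 1 = k - x by ring] at hdn
    rw [hdn, and_iff_right h2]

lemma isZero_northeast {k : ℕ} (hk : k < a + b) :
    P.IsZero k ((a + b : ℕ) - 1 - k) ↔ word a mu k = 0 := by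
  rw [show ((a + b : ℕ) : ℤ) - 1 - k = a + b - 1 - k by push_cast; ring]
  constructor
  · rintro ⟨p, hp, h⟩
    exact (P.northeast p hp k 0 hk h).symm
  · intro hw
    have hm := fun p hp l h => (P.northeast p hp k l hk h).trans hw
    rcases P.exists_up (x := k) (y := a + b - 1 - k) (up_mem_bigTriangle.2 (by push_cast; omega))
      with h1 | h1 | h1 | h1 | h1 | h1
    · exact ⟨_, h1, by simp [PuzzlePiece.sides]⟩
    · exact absurd (hm _ h1 1 (by simp [PuzzlePiece.sides])) (by simp)
    · exact ⟨_, h1, by simp [PuzzlePiece.sides]⟩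
    · exact absurd (hm _ h1 1 (by simp [PuzzlePiece.sides])) (by simp)
    · exact absurd (hm _ h1 1 (by simp [PuzzlePiece.sides])) (by simp)
    · exact absurd h1 nesw_notMem

/-- The bead at `x` of row `y`, as read off from the puzzle on the line below the strip of that
row. -/
def HasBead (P : Puzzle a b lam mu lam) (x : ℤ) (y : ℕ) : Prop :=
  (y < a ∧ (x + y < 0 ∨ P.IsZero (x + y) (zeroAt a lam y - 1 - (x + y)))) ∨
    (a ≤ y ∧ IsBead mu x)

/-- Beads are defined on the lines just before strips of letter `0`, and on the NE side through
`mu`. Going backwards from the NE side, strips of letter `1` transport them unchanged, so they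
describe the labels on every line. -/
lemma hasBead_iff (hm : ∀ i, a ≤ i → mu.rowLen i = 0) (hb : lam.rowLen 0 ≤ b)
    (hmu : mu.rowLen 0 ≤ lam.rowLen 0) {k : ℕ} (hk : k ≤ a + b) (x : ℤ) :
    P.HasBead (x - zeroCount a lam k) (zeroCount a lam k) ↔
      x < 0 ∨ (x < k ∧ P.IsZero x (k - 1 - x)) := by
  induction hk using Nat.decreasingInduction with
  | self =>
    rw [zeroCount_add hb, HasBead]
    simp only [lt_irrefl, false_and, le_refl, true_and, false_or]
    rcases lt_or_ge x 0 with h0 | h0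
    · simp only [h0, true_or, iff_true]
      exact isBead_of_lt_neg hm (by omega)
    · lift x to ℕ using h0
      rw [← word_eq_zero_iff_isBead hm, or_iff_right (by omega)]
      rcases Nat.lt_or_ge x (a + b) with h1 | h1
      · rw [and_iff_right (by exact_mod_cast h1), isZero_northeast h1]
      · refine ⟨fun h => ?_, fun h => absurd h.1 (by push_cast; omega)⟩
        obtain ⟨i, hi⟩ := (word_eq_zero_iff_isBead hm).1 h
        have := mu.rowLen_anti 0 i (Nat.zero_le i)
        omega
  | of_succ k hk ih =>
    by_cases hw : word a lam k = 1
    · rw [zeroCount_succ_of_one hw, isZero_succ_of_one hk hw] at ih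
      exact ih
    · rw [word_eq_one_iff, not_not] at hw
      obtain ⟨hc, hkc⟩ := (zeroCount_spec k).2.2.2 hw
      rw [HasBead, ← hkc, sub_add_cancel]
      simp only [hc, true_and, not_le.2 hc, false_and, or_false]
      refine or_congr_right ⟨fun h => ⟨?_, h⟩, fun h => h.2⟩
      have := nonneg_of_isZero h
      omega

-- In the strip of row `y`, an upward triangle sees the bead on the right line and a downward
-- triangle the bead on the left line, and both can share the same NW-SE rhombus. Inside the
-- triangle, bead plus increment on either side is 1 minus the indicator of that rhombus, which
-- yields the row relations.
open Classical in
lemma exists_heightFunction (hm : ∀ i, a ≤ i → mu.rowLen i = 0) (hb : lam.rowLen 0 ≤ b)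
    (hmu : mu.rowLen 0 ≤ lam.rowLen 0) (P : Puzzle a b lam mu lam) :
    ∃ H : HeightFunction lam mu a,
      (∀ x y, y ≤ a → H.val x y = H.val (x + 1) y + if P.HasBead x y then 1 else 0) ∧
      (∀ x y, y < a → H.val x (y + 1) = H.val x y +
        if ⟨.equivariant, x + y, zeroAt a lam y - (x + y)⟩ ∈ P.pieces then 1 else 0) := by
  have E_bounds : ∀ (x : ℤ) (y : ℕ), ⟨.equivariant, x + y, zeroAt a lam y - (x + y)⟩ ∈ P.pieces →
      0 ≤ x + y ∧ x + y < zeroAt a lam y := by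
    intro x y h
    have := down_of_mem (x := x + y) (y := zeroAt a lam y - (x + y) - 1) h (Or.inr rfl)
    omega
  have rows : ∀ (x : ℤ) (y : ℕ), y < a →
      ((if P.HasBead x (y + 1) then 1 else 0) +
        (if ⟨.equivariant, (x + 1) + y, zeroAt a lam y - ((x + 1) + y)⟩ ∈ P.pieces
          then 1 else 0) : ℕ) =
      (if P.HasBead x y then 1 else 0) +
        (if ⟨.equivariant, x + y, zeroAt a lam y - (x + y)⟩ ∈ P.pieces then 1 else 0) ∧
      ((if ⟨.equivariant, (x + 1) + y, zeroAt a lam y - ((x + 1) + y)⟩ ∈ P.pieces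
          then 1 else 0) + (if P.HasBead x (y + 1) then 1 else 0) : ℕ) ≤ 1 := by
    intro x y hy
    have hlt := zeroAt_lt_add hb hy
    have hw := word_zeroAt (m := lam) hy
    have hc := zeroCount_zeroAt (m := lam) hy
    have hc' := zeroCount_succ_of_zero hw
    have z0 := hasBead_iff (P := P) hm hb hmu hlt.le (x + y)
    have z1 := hasBead_iff (P := P) hm hb hmu (Nat.succ_le_of_lt hlt) (x + 1 + y)
    rw [hc, add_sub_cancel_right] at z0
    rw [Nat.succ_eq_add_one, hc', hc, show x + 1 + y - ((y + 1 : ℕ) : ℤ) = x by push_cast; ring,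
      show ((zeroAt a lam y + 1 : ℕ) : ℤ) - 1 - (x + 1 + y) = zeroAt a lam y - (x + 1 + y) by
        push_cast; ring] at z1
    have b0 := E_bounds x y
    have b1 := E_bounds (x + 1) y
    have hup := up_zero (P := P) (x := x + 1 + y) (y := zeroAt a lam y - (x + 1 + y)) (by ring)
      (k := zeroAt a lam y)
    have hdn := down_zero (P := P) (x := x + y) (y := zeroAt a lam y - (x + 1 + y)) (by ring)
      (k := zeroAt a lam y)
    have iup := isZero_iff_up (P := P) (x := x + 1 + y) (y := zeroAt a lam y - (x + 1 + y))
    have idn := isZero_iff_down (P := P) (x := x + y) (y := zeroAt a lam y - (x + 1 + y))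
    have nV : ⟨.rhombus .vertical, x + 1 + y, (zeroAt a lam y : ℤ) - (x + 1 + y)⟩ ∉ P.pieces :=
      vertical_notMem (by ring) hw
    have nV' : ⟨.rhombus .vertical, x + y, (zeroAt a lam y : ℤ) - (x + y)⟩ ∉ P.pieces :=
      vertical_notMem (by ring) hw
    have nN : ⟨.rhombus .nwse, x + 1 + y, (zeroAt a lam y : ℤ) - (x + 1 + y)⟩ ∈ P.pieces →
        0 ≤ x + y := fun h => by
      have := down_of_mem (x := x + 1 + y - 1) (y := zeroAt a lam y - (x + 1 + y)) h (Or.inr rfl)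
      omega
    rw [show (zeroAt a lam y : ℤ) - (x + 1 + y) + 1 = zeroAt a lam y - (x + y) by ring] at hdn idn
    rw [show x + y + 1 = x + 1 + y by ring] at hdn
    rw [show (zeroAt a lam y : ℤ) - 1 - (x + y) = zeroAt a lam y - (x + 1 + y) by ring] at z0
    simp only [up_mem_bigTriangle, down_mem_bigTriangle, Nat.cast_add, nV, nV', or_false, hw,
      true_implies] at hup hdn iup idn
    rw [z0, z1]
    generalize hk : zeroAt a lam y = k at *
    -- Left of the triangle only the conventional beads remain. At 0 the upward triangle touches the
    -- NW side, where a NW-SE rhombus does not fit. To the right, inside the triangle both covering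
    -- conditions apply; beyond it everything vanishes.
    rcases lt_trichotomy (x + 1 + y) 0 with h | h | h
    · simp only [show x + 1 + (y : ℤ) < 0 from h, show x + (y : ℤ) < 0 by omega, true_or, if_true,
        mt b0 (show ¬ (0 ≤ x + (y : ℤ) ∧ x + y < k) by omega),
        mt b1 (show ¬ (0 ≤ x + 1 + (y : ℤ) ∧ x + 1 + y < k) by omega), if_false]
      norm_num
    · have hup := hup (by omega)
      have iup := iup (by omega)
      have nN := mt nN (by omega)
      simp only [show ¬ x + 1 + (y : ℤ) < 0 by omega, show x + (y : ℤ) < 0 by omega, true_or,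
        if_true, mt b0 (show ¬ (0 ≤ x + (y : ℤ) ∧ x + y < k) by omega), if_false, false_or,
        show x + 1 + (y : ℤ) < (k + 1 : ℕ) by push_cast; omega, true_and, iup]
      simp only [nN, not_false_eq_true, and_true, and_false, or_false] at hup
      rcases hup with hup | hup <;> simp [hup.1, hup.2]
    · rcases lt_or_ge (k : ℤ) (x + 1 + y) with h2 | h2
      · simp only [show ¬ x + 1 + (y : ℤ) < 0 by omega, show ¬ x + (y : ℤ) < 0 by omega, if_false,
          mt b0 (show ¬ (0 ≤ x + (y : ℤ) ∧ x + y < k) by omega),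
          mt b1 (show ¬ (0 ≤ x + 1 + (y : ℤ) ∧ x + 1 + y < k) by omega), false_or,
          show ¬ x + 1 + (y : ℤ) < (k + 1 : ℕ) by push_cast; omega,
          show ¬ x + (y : ℤ) < k by omega, false_and]
        norm_num
      · have hup := hup (by omega)
        have iup := iup (by omega)
        have hdn := hdn (by omega)
        have idn := idn (by omega)
        simp only [show ¬ x + 1 + (y : ℤ) < 0 by omega, show ¬ x + (y : ℤ) < 0 by omega, false_or,
          show x + 1 + (y : ℤ) < (k + 1 : ℕ) by push_cast; omega,
          show x + (y : ℤ) < k by omega, true_and, iup, idn]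
        rcases hup with hup | hup | hup <;> rcases hdn with hdn | hdn | hdn <;>
          simp_all
  refine HeightFunction.exists_of_rows
    (z := fun x y => if P.HasBead x y then 1 else 0)
    (e := fun x y => if ⟨.equivariant, x + y, zeroAt a lam y - (x + y)⟩ ∈ P.pieces then 1 else 0)
    (fun x => ?_) (fun x hx => ?_) (fun x hx => ?_) (fun x y hy => (rows x y hy).1)
    (fun x y hy => (rows x y hy).2) (fun x y hy hx => ?_)
  · have := hasBead_iff (P := P) hm hb hmu (Nat.zero_le _) x
    rw [zeroCount_zero] at this
    simp only [Nat.cast_zero, sub_zero] at this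
    have h2 : P.HasBead x 0 ↔ x < 0 := this.trans ⟨fun h => h.elim id fun h => h.1, Or.inl⟩
    simp only [h2]
  · simp [HasBead, hx]
  · simp [HasBead, hx]
  · refine if_neg fun h => ?_
    have := (E_bounds x y h).2
    rw [zeroAt] at this
    omega

end Puzzle

/-! ### Every puzzle comes from a height function -/

namespace HeightFunction

variable {a b : ℕ} {lam mu : YoungDiagram}

open Puzzle in
lemma toPuzzle_surjective (hm : ∀ i, a ≤ i → mu.rowLen i = 0) (hb : lam.rowLen 0 ≤ b)
    (hmu : mu.rowLen 0 ≤ lam.rowLen 0) :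
    Function.Surjective fun H : HeightFunction lam mu a => H.toPuzzle hm hb := by
  intro P
  obtain ⟨H, Hz, He⟩ := P.exists_heightFunction hm hb hmu
  refine ⟨H, (Puzzle.eq_of_subset fun p hp => ?_).symm⟩
  rw [mem_toPuzzle]
  -- The labels predicted by the reconstructed heights agree with those of `P`; each piece is then
  -- recognised by its labels.
  have line : ∀ {k : ℕ} {x y : ℤ}, k ≤ a + b → x + y + 1 = k → 0 ≤ x → 0 ≤ y →
      (H.LineZero x k ↔ P.IsZero x y) := by
    intro k x y hk hxy hx hy
    have h1 := hasBead_iff (P := P) hm hb hmu hk x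
    rw [or_iff_right (by omega), and_iff_right (by omega), show (k : ℤ) - 1 - x = y by omega]
      at h1
    rw [← h1, LineZero, Hz _ _ (zeroCount_spec k).1]
    by_cases h : P.HasBead (x - zeroCount a lam k) (zeroCount a lam k) <;> simp [h]
  rcases p with ⟨κ, x, y⟩
  rcases κ with l | l | o | _
  · have hR := P.subset _ hp rfl
    have hbd := up_of_mem hp rfl
    obtain ⟨k, hk⟩ := Int.eq_ofNat_of_zero_le (show 0 ≤ x + y by omega)
    rw [H.isPiece_upTri hk, line (by omega) (by push_cast; omega) hbd.1 hbd.2.1]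
    exact ⟨hR, word_of_slash hk hR hp (by simp [PuzzlePiece.sides]),
      isZero_iff_of_mem hp (by simp [PuzzlePiece.sides])⟩
  · have hR := P.subset _ hp rfl
    have hbd := down_of_mem (x := x) (y := y) hp rfl
    obtain ⟨k, hk⟩ := Int.eq_ofNat_of_zero_le (show 0 ≤ x + y + 1 by omega)
    rw [H.isPiece_downTri hk, line (by omega) hk hbd.1 hbd.2.1]
    exact ⟨hR, word_of_slash (x := x + 1) (y := y) (by omega)
      (up_mem_bigTriangle.2 (by push_cast; omega)) hp (by simp [PuzzlePiece.sides]),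
      isZero_iff_of_mem hp (by simp [PuzzlePiece.sides])⟩
  · cases o
    · have hR := P.subset _ hp (Or.inl rfl)
      have hbd := up_of_mem hp (Or.inl rfl)
      have hbd' := down_of_mem (y := y - 1) hp (Or.inr rfl)
      obtain ⟨k, hk⟩ := Int.eq_ofNat_of_zero_le (show 0 ≤ x + y by omega)
      rw [H.isPiece_vertical hk, line (y := y - 1) (by omega) (by omega) hbd.1 hbd'.2.1]
      exact ⟨by omega, word_of_slash hk hR hp (by simp [PuzzlePiece.sides]),
        (isZero_iff_of_mem hp (l := 0) (by simp [PuzzlePiece.sides])).2 rfl⟩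
    · have hR := P.subset _ hp (Or.inl rfl)
      have hbd := up_of_mem hp (Or.inl rfl)
      have hbd' := down_of_mem (x := x - 1) hp (Or.inr rfl)
      obtain ⟨k, hk⟩ := Int.eq_ofNat_of_zero_le (show 0 ≤ x + y by omega)
      have hw : word a lam k = 0 := by
        by_contra hw
        have h1 := (isOne_iff (P := P) hk hR).2 (word_eq_one_iff.2 hw)
        simpa using isOne_ne h1 hp (Or.inl rfl)
      obtain ⟨hc, hkc⟩ := (zeroCount_spec k).2.2.2 hw
      rw [H.isPiece_nwse hk]
      refine ⟨by omega, hw, ?_⟩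
      have h1 := H.lineZero_succ_of_zero (x := x) hw
      rw [line (by omega) (y := y) (by push_cast; omega) hbd.1 hbd.2.1,
        isZero_iff_of_mem hp (l := 1) (by simp [PuzzlePiece.sides])] at h1
      -- The label `1` on the right side excludes a bead, and the upward triangle is not in an
      -- equivariant piece, so neither of the two possible jumps occurs.
      have h2 := H.val_le (x - zeroCount a lam k - 1) (zeroCount a lam k + 1)
      have h3 := H.val_add_one_le (x - zeroCount a lam k - 1) (zeroCount a lam k + 1)
      rw [sub_add_cancel] at h2 h3
      have h4 := He (x - zeroCount a lam k) _ hc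
      rw [← hkc, sub_add_cancel, show (k : ℤ) - x = y by omega, if_neg] at h4
      · have h5 := mt h1.2 (by simp)
        omega
      · intro h
        simpa using up_unique h hp (Or.inl rfl) (Or.inl rfl)
    · exact absurd hp nesw_notMem
  · have hR := P.subset _ hp (Or.inl rfl)
    have hbd := up_of_mem hp (Or.inl rfl)
    have hbd' := down_of_mem (y := y - 1) hp (Or.inr rfl)
    obtain ⟨k, hk⟩ := Int.eq_ofNat_of_zero_le (show 0 ≤ x + y by omega)
    have hw := word_of_slash (l := 0) hk hR hp (by simp [PuzzlePiece.sides])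
    obtain ⟨hc, hkc⟩ := (zeroCount_spec k).2.2.2 hw
    rw [H.isPiece_equivariant hk]
    refine ⟨by omega, hw, ?_⟩
    have h4 := He (x - zeroCount a lam k) _ hc
    rwa [← hkc, sub_add_cancel, show (k : ℤ) - x = y by omega, if_pos hp] at h4

end HeightFunction

/-- Height functions are the same as equivariant puzzles. -/
noncomputable def puzzleEquiv {a b : ℕ} {lam mu : YoungDiagram}
    (hm : ∀ i, a ≤ i → mu.rowLen i = 0) (hb : lam.rowLen 0 ≤ b)
    (hmu : mu.rowLen 0 ≤ lam.rowLen 0) : HeightFunction lam mu a ≃ Puzzle a b lam mu lam :=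
  Equiv.ofBijective _
    ⟨HeightFunction.toPuzzle_injective hm hb, HeightFunction.toPuzzle_surjective hm hb hmu⟩

lemma mem_puzzleEquiv {a b : ℕ} {lam mu : YoungDiagram}
    {hm : ∀ i, a ≤ i → mu.rowLen i = 0} {hb : lam.rowLen 0 ≤ b}
    {hmu : mu.rowLen 0 ≤ lam.rowLen 0} {H : HeightFunction lam mu a} {p : PuzzlePiece} :
    p ∈ (puzzleEquiv hm hb hmu H).pieces ↔ H.IsPiece b p :=
  H.mem_toPuzzle (hm := hm) (hb := hb)

lemma prod_eq_of_equiv {α β : Type*} {s : Finset α} {t : Finset β} {f : α → ℤ} {g : β → ℤ}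
    (e : {x // x ∈ s} ≃ {y // y ∈ t}) (h : ∀ x, g (e x).1 = f x.1) :
    ∏ x ∈ s, (f x : ℚ) = ∏ y ∈ t, (g y : ℚ) := by
  rw [← Finset.prod_coe_sort s, ← Finset.prod_coe_sort t]
  exact Fintype.prod_equiv e _ _ fun x => by rw [h]

/-! ### Matching cells, rhombi and equivariant pieces with their weights -/

section correspondence

variable {lam mu : YoungDiagram}

lemma mem_nwseRhombi_tilingEquiv {hmu : mu ≤ lam} {H : HeightFunction lam mu (lam.colLen 0)}
    {r : Lozenge} : r ∈ nwseRhombi (tilingEquiv hmu H) ↔ ∃ (x : ℤ) (y : ℕ),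
      r = ⟨.nwse, x, y⟩ ∧ y < lam.colLen 0 ∧ H.val x (y + 1) = H.val x y + 1 := by
  rw [nwseRhombi, Finset.mem_filter, mem_tilingEquiv]
  constructor
  · rintro ⟨h1, h2⟩
    obtain ⟨o, x, y⟩ := r
    obtain rfl : o = .nwse := h2
    have hy : 0 ≤ y := h1.1
    lift y to ℕ using hy
    exact ⟨x, y, rfl, (H.isLozenge_nwse x y).1 h1⟩
  · rintro ⟨x, y, rfl, h⟩
    exact ⟨(H.isLozenge_nwse x y).2 h, rfl⟩

/-- The cells of a tableau correspond to the NW-SE rhombi of the tiling. -/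
lemma exists_equiv_rhombi (hmu : mu ≤ lam) (H : HeightFunction lam mu (lam.colLen 0)) :
    ∃ α : {u // u ∈ mu.cells} ≃ {r // r ∈ nwseRhombi (tilingEquiv hmu H)},
      ∀ u, (α u).1.y + 1 = ((ootEquiv H).1.1 u.1.1 u.1.2 : ℤ) ∧
        rhombusWeight lam (α u).1 = cellWeight lam (ootEquiv H).1.1 u.1 := by
  have spec : ∀ u : {u // u ∈ mu.cells}, ∃ y, y < lam.colLen 0 ∧ H.entry u.1.1 u.1.2 = y + 1 ∧
      H.val (content u.1) y = u.1.1 ∧ H.val (content u.1) (y + 1) = u.1.1 + 1 := fun u =>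
    H.entry_spec (HeightFunction.mem_cells_iff.1 u.2)
  choose row row_lt entry_eq val_eq val_succ using spec
  let f : {u // u ∈ mu.cells} → {r // r ∈ nwseRhombi (tilingEquiv hmu H)} := fun u =>
    ⟨⟨.nwse, content u.1, row u⟩, mem_nwseRhombi_tilingEquiv.2
      ⟨_, _, rfl, row_lt u, by rw [val_eq, val_succ]⟩⟩
  have hf : Function.Bijective f := by
    constructor
    · intro u v huv
      have h : (⟨.nwse, content u.1, row u⟩ : Lozenge) = ⟨.nwse, content v.1, row v⟩ :=
        congrArg Subtype.val huv
      simp only [Lozenge.mk.injEq, Nat.cast_inj, true_and] at h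
      -- The height at the lower end of the rhombus recovers the row of the cell; the content then
      -- gives the column.
      have h1 := val_eq u
      rw [h.1, h.2, val_eq v] at h1
      have h2 := h.1
      rw [content, content] at h2
      exact Subtype.ext (Prod.ext h1.symm (by omega))
    · rintro ⟨r, hr⟩
      obtain ⟨x, y, rfl, hy, hstep⟩ := mem_nwseRhombi_tilingEquiv.1 hr
      have h1 := H.toNat_neg_le x y
      -- The preimage of a rhombus at `(x, y)` is the cell of content `x` in the row whose index is
      -- the height before the increment.
      obtain ⟨j, hj⟩ := Int.eq_ofNat_of_zero_le (show 0 ≤ (H.val x y : ℤ) + x by omega)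
      have hm : j < mu.rowLen (H.val x y) := by
        have := H.lt_rowLen_of_lt (x := x) (y := y + 1) (i := H.val x y) (by omega)
        omega
      have hx : (j : ℤ) - H.val x y = x := by omega
      let u : {u // u ∈ mu.cells} := ⟨(H.val x y, j), HeightFunction.mem_cells_iff.2 hm⟩
      refine ⟨u, Subtype.ext ?_⟩
      have h2 := (H.entry_le_iff hm (y + 1)).2 (by rw [hx]; omega)
      have h3 := mt (H.entry_le_iff hm y).1 (by rw [hx]; omega)
      have h4 : H.entry (H.val x y) j = row u + 1 := entry_eq u
      have h5 : row u = y := by omega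
      change (⟨.nwse, (j : ℤ) - H.val x y, row u⟩ : Lozenge) = ⟨.nwse, x, y⟩
      rw [hx, h5]
  refine ⟨Equiv.ofBijective f hf, fun u => ?_⟩
  have h : (ootEquiv H).1.1 u.1.1 u.1.2 = row u + 1 := entry_eq u
  rw [cellWeight, h]
  refine ⟨by simp [f], ?_⟩
  change rightEnd lam (row u) - content u.1 = _
  rw [rightEnd_natCast, Nat.sub_sub, add_comm 1]

lemma mem_equivariantPieces_puzzleEquiv {a b : ℕ} {hm : ∀ i, a ≤ i → mu.rowLen i = 0}
    {hb : lam.rowLen 0 ≤ b} {hr : mu.rowLen 0 ≤ lam.rowLen 0} {H : HeightFunction lam mu a}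
    {p : PuzzlePiece} : p ∈ equivariantPieces (puzzleEquiv hm hb hr H) ↔ ∃ (x : ℤ) (y : ℕ),
      p = ⟨.equivariant, x + y, zeroAt a lam y - (x + y)⟩ ∧ y < a ∧
        H.val x (y + 1) = H.val x y + 1 := by
  rw [equivariantPieces, Finset.mem_filter, mem_puzzleEquiv]
  constructor
  · rintro ⟨h1, h2⟩
    obtain ⟨κ, x, y⟩ := p
    obtain rfl : κ = .equivariant := h2
    obtain ⟨-, k, hk, hw, h⟩ := h1
    obtain ⟨hc, hkc⟩ := (zeroCount_spec k).2.2.2 hw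
    simp only at hk h
    refine ⟨_, _, ?_, hc, h⟩
    rw [← hkc, sub_add_cancel, ← hk, add_sub_cancel_left]
  · rintro ⟨x, y, rfl, hy, h⟩
    exact ⟨(H.isPiece_equivariant_iff hb hy).2 h, rfl⟩

/-- The NW-SE rhombi of a tiling correspond to the equivariant pieces of the puzzle. -/
lemma exists_equiv_pieces (hmu : mu ≤ lam) {b m : ℕ}
    (hm : ∀ i, lam.colLen 0 + m ≤ i → mu.rowLen i = 0) (hb : lam.rowLen 0 ≤ b)
    (hr : mu.rowLen 0 ≤ lam.rowLen 0) (H : HeightFunction lam mu (lam.colLen 0)) :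
    ∃ β : {r // r ∈ nwseRhombi (tilingEquiv hmu H)} ≃
        {p // p ∈ equivariantPieces (puzzleEquiv hm hb hr (H.shift le_rfl m))},
      ∀ r, height (β r).1 = rhombusWeight lam r.1 ∧
        strip (β r).1 = (zeroPos (lam.colLen 0 + m) lam (rowFromTop lam r.1.y) : ℤ) := by
  have spec : ∀ r : {r // r ∈ nwseRhombi (tilingEquiv hmu H)}, ∃ (x : ℤ) (y : ℕ),
      r.1 = ⟨.nwse, x, y⟩ ∧ y < lam.colLen 0 ∧ H.val x (y + 1) = H.val x y + 1 := fun r =>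
    mem_nwseRhombi_tilingEquiv.1 r.2
  choose col row eq_mk row_lt step using spec
  let f : {r // r ∈ nwseRhombi (tilingEquiv hmu H)} →
      {p // p ∈ equivariantPieces (puzzleEquiv hm hb hr (H.shift le_rfl m))} := fun r =>
    ⟨⟨.equivariant, col r + (row r + m : ℕ),
        zeroAt (lam.colLen 0 + m) lam (row r + m) - (col r + (row r + m : ℕ))⟩,
      mem_equivariantPieces_puzzleEquiv.2 ⟨_, _, rfl, by have := row_lt r; omega, by
        rw [HeightFunction.shift_val, HeightFunction.shift_val, Nat.add_right_comm,
          Nat.add_sub_cancel, Nat.add_sub_cancel, step r]⟩⟩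
  have hf : Function.Bijective f := by
    constructor
    · intro r s hrs
      have h := congrArg Subtype.val hrs
      simp only [f, PuzzlePiece.mk.injEq, true_and] at h
      have h1 : row r = row s := by
        rcases lt_trichotomy (row r) (row s) with h2 | h2 | h2
        · have := zeroAt_lt (a := lam.colLen 0 + m) (m := lam) (Nat.add_lt_add_right h2 m)
          omega
        · exact h2
        · have := zeroAt_lt (a := lam.colLen 0 + m) (m := lam) (Nat.add_lt_add_right h2 m)
          omega
      have h2 : col r = col s := by
        have := h.1
        rw [h1] at this
        omega
      exact Subtype.ext (by rw [eq_mk r, eq_mk s, h1, h2])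
    · rintro ⟨p, hp⟩
      obtain ⟨x, y, rfl, hy, hstep⟩ := mem_equivariantPieces_puzzleEquiv.1 hp
      rw [HeightFunction.shift_val, HeightFunction.shift_val] at hstep
      -- The `m` prepended rows are constant, hence contain no increments.
      have hmy : m ≤ y := by
        by_contra h
        rw [show y + 1 - m = 0 by omega, show y - m = 0 by omega] at hstep
        omega
      rw [Nat.sub_add_comm hmy] at hstep
      let r : {r // r ∈ nwseRhombi (tilingEquiv hmu H)} :=
        ⟨⟨.nwse, x, (y - m : ℕ)⟩,
          mem_nwseRhombi_tilingEquiv.2 ⟨x, y - m, rfl, by omega, hstep⟩⟩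
      have h := eq_mk r
      simp only [r, Lozenge.mk.injEq, true_and, Nat.cast_inj] at h
      obtain ⟨h1, h2⟩ := h
      refine ⟨r, Subtype.ext ?_⟩
      simp only [f, r]
      rw [← h1, ← h2, Nat.sub_add_cancel hmy]
  refine ⟨Equiv.ofBijective f hf, fun r => ?_⟩
  have h1 := row_lt r
  have h2 : zeroAt (lam.colLen 0 + m) lam (row r + m) =
      lam.rowLen (lam.colLen 0 - 1 - row r) + (row r + m) := by
    rw [zeroAt, show lam.colLen 0 + m - 1 - (row r + m) = lam.colLen 0 - 1 - row r by omega]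
  have h3 : rowFromTop lam (row r) = lam.colLen 0 - 1 - row r := rfl
  rw [eq_mk r]
  constructor
  · change (zeroAt (lam.colLen 0 + m) lam (row r + m) : ℤ) - (col r + (row r + m : ℕ)) =
      rightEnd lam (row r) - col r
    rw [h2, rightEnd_natCast]
    push_cast
    ring
  · change col r + (row r + m : ℕ) +
      ((zeroAt (lam.colLen 0 + m) lam (row r + m) : ℤ) - (col r + (row r + m : ℕ))) = _
    rw [h3, zeroPos, h2]
    push_cast
    omega

end correspondence
end OOKT

/-! ### Composition of the bijections -/

theorem theorem1p6 (lam mu : YoungDiagram) (hmu : mu ≤ lam) (a b : ℕ)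
    (ha : lam.colLen 0 ≤ a) (hb : lam.rowLen 0 ≤ b) :
    -- the nonzero terms of the Okounkov–Olshanski formula are indexed by `OOT lam mu`
    (∀ T : OOKT.SSYTBounded mu (lam.colLen 0),
      OOKT.ooTerm lam T.1 ≠ 0 ↔ OOKT.IsOO lam T.1) ∧
    ∃ (Φ : OOKT.OOT lam mu ≃ OOKT.LozengeTiling (OOKT.nabla lam mu))
      (Ψ : OOKT.LozengeTiling (OOKT.nabla lam mu) ≃ OOKT.Puzzle a b lam mu lam),
      -- cells of tableaux become NW-SE rhombi, with the same weights; an entry is the number of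
      -- the row of the rhombus, counted from the bottom
      (∀ T : OOKT.OOT lam mu,
        ∃ α : {u // u ∈ mu.cells} ≃ {r // r ∈ OOKT.nwseRhombi (Φ T)},
          ∀ u, (α u).1.y + 1 = (T.1.1 u.1.1 u.1.2 : ℤ) ∧
            OOKT.rhombusWeight lam (α u).1 = OOKT.cellWeight lam T.1.1 u.1) ∧
      -- NW-SE rhombi become equivariant pieces, and weights become heights; the rows of the region
      -- become the strips at the zeros of the word of `lam`
      (∀ t : OOKT.LozengeTiling (OOKT.nabla lam mu),
        ∃ β : {r // r ∈ OOKT.nwseRhombi t} ≃ {p // p ∈ OOKT.equivariantPieces (Ψ t)},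
          ∀ r, OOKT.height (β r).1 = OOKT.rhombusWeight lam r.1 ∧
            OOKT.strip (β r).1 =
              (OOKT.zeroPos a lam (OOKT.rowFromTop lam r.1.y) : ℤ)) ∧
      -- corresponding terms of the formulas are equal
      (∀ T : OOKT.OOT lam mu, OOKT.ooTerm lam T.1.1 = OOKT.tilingTerm lam mu (Φ T)) ∧
      (∀ t : OOKT.LozengeTiling (OOKT.nabla lam mu),
        OOKT.tilingTerm lam mu t = OOKT.puzzleTerm lam mu (Ψ t)) := by
  obtain ⟨m, rfl⟩ := Nat.exists_eq_add_of_le ha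
  have hm : ∀ i, lam.colLen 0 + m ≤ i → mu.rowLen i = 0 := fun i hi =>
    OOKT.rowLen_eq_zero_of_le hmu (by omega)
  have hr : mu.rowLen 0 ≤ lam.rowLen 0 := by
    by_contra h
    have h1 : (0, lam.rowLen 0) ∈ mu := YoungDiagram.mem_iff_lt_rowLen.2 (by omega)
    exact lt_irrefl _ (YoungDiagram.mem_iff_lt_rowLen.1 (hmu h1))
  set Φ := OOKT.ootEquiv.symm.trans (OOKT.tilingEquiv hmu) with hΦ
  -- Tilings have as many rows as `lam` has parts and puzzles have `a`; `shift` bridges the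
  -- difference.
  set Ψ := (OOKT.tilingEquiv hmu).symm.trans
    ((OOKT.HeightFunction.shift le_rfl m).trans (OOKT.puzzleEquiv hm hb hr)) with hΨ
  have hα : ∀ T : OOKT.OOT lam mu,
      ∃ α : {u // u ∈ mu.cells} ≃ {r // r ∈ OOKT.nwseRhombi (Φ T)},
        ∀ u, (α u).1.y + 1 = (T.1.1 u.1.1 u.1.2 : ℤ) ∧
          OOKT.rhombusWeight lam (α u).1 = OOKT.cellWeight lam T.1.1 u.1 := by
    intro T
    obtain ⟨H, rfl⟩ := OOKT.ootEquiv.surjective T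
    rw [hΦ, Equiv.trans_apply, Equiv.symm_apply_apply]
    exact OOKT.exists_equiv_rhombi hmu H
  have hβ : ∀ t : OOKT.LozengeTiling (OOKT.nabla lam mu),
      ∃ β : {r // r ∈ OOKT.nwseRhombi t} ≃ {p // p ∈ OOKT.equivariantPieces (Ψ t)},
        ∀ r, OOKT.height (β r).1 = OOKT.rhombusWeight lam r.1 ∧
          OOKT.strip (β r).1 =
            (OOKT.zeroPos (lam.colLen 0 + m) lam (OOKT.rowFromTop lam r.1.y) : ℤ) := by
    intro t
    obtain ⟨H, rfl⟩ := (OOKT.tilingEquiv hmu).surjective t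
    rw [hΨ, Equiv.trans_apply, Equiv.symm_apply_apply]
    exact OOKT.exists_equiv_pieces hmu hm hb hr H
  refine ⟨fun T => OOKT.ooTerm_ne_zero_iff, Φ, Ψ, hα, hβ, fun T => ?_, fun t => ?_⟩
  · obtain ⟨α, h⟩ := hα T
    rw [OOKT.ooTerm, OOKT.tilingTerm, OOKT.prod_eq_of_equiv α fun u => (h u).2]
  · obtain ⟨β, h⟩ := hβ t
    rw [OOKT.tilingTerm, OOKT.puzzleTerm, OOKT.prod_eq_of_equiv β fun r => (h r).1]
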